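/- **Setting.** All provability is provability in intuitionistic first-order logic with equality. The language of geometry has variables for points, the ternary relation $B(a,b,c)$ ("$b$ is strictly between $a$ and $c$") and the quaternary relation $ab=cd$ (congruence of segments). Put $T(a,b,c):=\neg(a\ne b\wedge b\ne c\wedge\neg B(a,b,c))$; a line is given by two distinct points, and $x$ lies on $\mathrm{Line}(a,b)$ if $\neg\neg(B(a,b,x)\vee B(b,x,a)\vee B(x,a,b)\vee x=a\vee x=b)$; $ab\le cd$ means that $ce=ab$ for some $e$ with $T(c,e,d)$. Two lines are parallel if they have no common point. A *theory of neutral constructive geometry* is a set $\mathcal T$ of sentences of this language that proves: stability ($\neg\neg A\to A$) of equality, $B$ and congruence; strictness ($B(a,b,c)$ implies that $a,b,c$ are distinct) and symmetry of $B$; outer transitivity $T(a,b,c)\wedge T(b,c,d)\wedge b\ne c\to T(a,c,d)\wedge T(a,b,d)$, inner transitivity $T(a,b,d)\wedge T(b,c,d)\to T(a,b,c)\wedge T(a,c,d)$ and transitivity $T(a,b,c)\wedge T(a,c,d)\to T(b,c,d)\wedge T(a,b,d)$; comparability ($B(a,b,c)\wedge B(a,b,d)\wedge\neg T(a,c,d)\to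 T(a,d,c)$); $ab=ba$; $ab=pq\wedge ab=rs\to pq=rs$; $ab=cc\to a=b$; the five-segment axiom ($a\ne b$, $T(a,b,c)$, $T(a',b',c')$, $ab=a'b'$, $bc=b'c'$, $ad=a'd'$ and $bd=b'd'$ imply $cd=c'd'$); segment extension (if $a\ne b$ then $T(a,b,x)\wedge bx=cd$ for some $x$); inner Pasch for non-collinear $a,b,c$ (if $B(a,p,c)$ and $B(b,q,c)$ then $B(p,x,b)\wedge B(q,x,a)$ for some $x$); the lower dimension axiom (there are three non-collinear points) and the upper dimension axiom (points equidistant from two distinct points are collinear); line-circle continuity (if $a\ne b$ are respectively non-strictly inside and non-strictly outside a circle, then some point $x$ of the circle satisfies $T(a,x,b)$); and circle-circle continuity for circles with distinct centers (if one has a point non-strictly inside and a point non-strictly outside the other, then they have a common point). It may have further axioms. (A theory in a richer language is represented by the set of its theorems in this language.) *Playfair ring theory* is the theory, in the language $0,1,-,+,\cdot,P$ ($P(x)$: "$x$ is positive"; $x<y:\leftrightarrow P(y-x)$; $x\le y:\leftrightarrow\neg\, y<x$), of commutative rings with: $\neg\, x\neq y\to x=y$; $0\ne 1$; $P(x)\wedge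 P(y)\to P(x+y)\wedge P(xy)$; $x+y=0\to\neg(P(x)\wedge P(y))$; $x+y=0\wedge\neg P(x)\wedge\neg P(y)\to x=0$; $0\le x\to\exists z\,(0\le z\wedge z^2=x)$; $\neg\neg P(x)\to P(x)$; $\forall y\,(xy\neq1)\to x=0$; and bounded quotients: $|a|\le|b|y\to\exists z\,(a=bz)$, where $|a|$ denotes the non-negative square root of $a^2$. The *analytic-geometry interpretation* $\varphi\mapsto\bar\varphi$ replaces each point variable by a pair of ring variables and a quantifier over points by two quantifiers, keeps the connectives, and interprets equality of points coordinatewise, $B(a,b,c)$ as $(c-b)\times(b-a)=0\wedge P((b-c)\cdot(a-b))$, and $ab=cd$ as $(b-a)^2=(d-c)^2$. It is *sound* from $\mathcal T$ to Playfair ring theory if $\bar\varphi$ is provable in Playfair ring theory for every axiom $\varphi$ of $\mathcal T$ (hence for every theorem). The following principles are universally quantified over all points in them. * *Playfair's axiom*: if lines $K$ and $M$ are parallel to the line $L$, and $p$ lies on $K$ and on $M$, then every $q$ lies on $K$ if and only if it lies on $M$. * *Strong parallel postulate*: if $B(p,t,q)$, $B(s,t,r)$, $pt=qt$, $rt=st$,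 $s\ne q$, $p\neq r$, $p\ne a$, $p$ is not on $L=\mathrm{Line}(s,q)$ and $a$ is not on $\mathrm{Line}(p,r)$, then some point lies on both $L$ and $\mathrm{Line}(p,a)$. * *Euclid 5*: if $B(q,a,r)$, $B(p,t,q)$, $B(s,t,r)$, $pt=qt$, $rt=st$, $p\ne r$, $s\ne q$, $p\ne a$ and $p$ is not on $L=\mathrm{Line}(s,q)$, then there is a point $e$ on $L$ and on $\mathrm{Line}(p,a)$ with $B(p,a,e)$ and $B(s,q,e)$. * *Triangle circumscription principle*: for non-collinear $a,b,c$ some point is equidistant from $a,b,c$. *Non-uniform version*: the same for any three points $a,b,c$ that are not both pairwise distinct and collinear. * *Strong triangle circumscription principle*: if $a,b$ lie on the line $L$ and $c$ does not, then some $e$ is equidistant from $a,b,c$ and, if $a=b$, the circle with center $e$ through $a$ meets $L$ only in $a$. *One-sided version*: the same under the additional hypothesis that $a$ and $b$ do not lie on opposite sides of the perpendicular from $c$ to $L$ (no point of that perpendicular is strictly between $a$ and $b$). **Theorem.** Let $\mathcal T$ be a theory of neutral constructive geometry such that the analytic-geometry interpretation is sound from $\mathcal T$ to Playfair ring theory.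 Then $\mathcal T$ proves that the strong parallel postulate implies Playfair's axiom, but $\mathcal T$ does not prove that Playfair's axiom implies the strong parallel postulate. **Corollary.** $\mathcal T$ does not prove that Playfair's axiom implies Euclid 5, nor that it implies the triangle circumscription principle, the strong, the one-sided, or the non-uniform triangle circumscription principle. -/

import Mathlib

namespace ConstructiveGeometry

/-! ### Intuitionistic first-order logic with equality -/

/-- First-order formulas over `L` with free variables among `0, …, n - 1`. All connectives and both
quantifiers are primitive, as intuitionistic logic requires. The variable bound by `all` or `ex` in
a formula with `n` free variables is the variable `n`; the other variables keep their numbers. -/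
inductive Form (L : FirstOrder.Language.{0, 0}) : ℕ → Type
  | falsum {n : ℕ} : Form L n
  | equal {n : ℕ} (s t : L.Term (Fin n)) : Form L n
  | rel {n l : ℕ} (R : L.Relations l) (ts : Fin l → L.Term (Fin n)) : Form L n
  | and {n : ℕ} (φ ψ : Form L n) : Form L n
  | or {n : ℕ} (φ ψ : Form L n) : Form L n
  | imp {n : ℕ} (φ ψ : Form L n) : Form L n
  | all {n : ℕ} (φ : Form L (n + 1)) : Form L n
  | ex {n : ℕ} (φ : Form L (n + 1)) : Form L n

infix:62 " ≐ " => Form.equal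
infixr:60 " ⋏ " => Form.and
infixr:55 " ⋎ " => Form.or
infixr:50 " ⇛ " => Form.imp

namespace Form

variable {L : FirstOrder.Language.{0, 0}}

/-- Negation is implication of absurdity. -/
def neg {n : ℕ} (φ : Form L n) : Form L n := φ ⇛ falsum

def iff {n : ℕ} (φ ψ : Form L n) : Form L n := (φ ⇛ ψ) ⋏ (ψ ⇛ φ)

/-- A substitution, carried under a binder. -/
def liftSubst {n m : ℕ} (σ : Fin n → L.Term (Fin m)) : Fin (n + 1) → L.Term (Fin (m + 1)) :=
  Fin.snoc (α := fun _ => L.Term (Fin (m + 1)))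
    (fun i => (σ i).relabel Fin.castSucc) (FirstOrder.Language.Term.var (Fin.last m))

/-- Simultaneous (capture-free) substitution of terms for the free variables. -/
def subst : {n m : ℕ} → Form L n → (Fin n → L.Term (Fin m)) → Form L m
  | _, _, falsum, _ => falsum
  | _, _, equal s t, σ => equal (s.subst σ) (t.subst σ)
  | _, _, rel R ts, σ => rel R fun i => (ts i).subst σ
  | _, _, and φ ψ, σ => and (φ.subst σ) (ψ.subst σ)
  | _, _, or φ ψ, σ => or (φ.subst σ) (ψ.subst σ)
  | _, _, imp φ ψ, σ => imp (φ.subst σ) (ψ.subst σ)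
  | _, _, all φ, σ => all (φ.subst (liftSubst σ))
  | _, _, ex φ, σ => ex (φ.subst (liftSubst σ))

/-- Regard a formula in `n` variables as one in `n + 1` variables. -/
def weaken {n : ℕ} (φ : Form L n) : Form L (n + 1) :=
  φ.subst fun i => FirstOrder.Language.Term.var i.castSucc

/-- Regard a sentence as a formula in `n` variables. -/
def ofSentence (n : ℕ) (φ : Form L 0) : Form L n := φ.subst fun i => i.elim0

/-- Substitute `t` for the last variable. -/
def inst {n : ℕ} (φ : Form L (n + 1)) (t : L.Term (Fin n)) : Form L n :=
  φ.subst (Fin.snoc (α := fun _ => L.Term (Fin n)) (fun i => FirstOrder.Language.Term.var i) t)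

/-- Universal closure. -/
def close : {n : ℕ} → Form L n → Form L 0
  | 0, φ => φ
  | _ + 1, φ => close (all φ)

end Form

/-- Natural deduction for intuitionistic first-order logic with equality (over non-empty domains):
`Derives T Γ φ` says that `φ` is derivable from the axioms `T` (sentences) and the assumptions `Γ`. -/
inductive Derives {L : FirstOrder.Language.{0, 0}} (T : Set (Form L 0)) :
    {n : ℕ} → List (Form L n) → Form L n → Prop
  | ax {n : ℕ} {Γ : List (Form L n)} {φ : Form L 0} (h : φ ∈ T) : Derives T Γ (φ.ofSentence n)
  | hyp {n : ℕ} {Γ : List (Form L n)} {φ : Form L n} (h : φ ∈ Γ) : Derives T Γ φ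
  | falsumE {n : ℕ} {Γ : List (Form L n)} {φ : Form L n} (h : Derives T Γ Form.falsum) :
      Derives T Γ φ
  | andI {n : ℕ} {Γ : List (Form L n)} {φ ψ : Form L n} (h₁ : Derives T Γ φ)
      (h₂ : Derives T Γ ψ) : Derives T Γ (φ ⋏ ψ)
  | andE₁ {n : ℕ} {Γ : List (Form L n)} {φ ψ : Form L n} (h : Derives T Γ (φ ⋏ ψ)) : Derives T Γ φ
  | andE₂ {n : ℕ} {Γ : List (Form L n)} {φ ψ : Form L n} (h : Derives T Γ (φ ⋏ ψ)) : Derives T Γ ψ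
  | orI₁ {n : ℕ} {Γ : List (Form L n)} {φ ψ : Form L n} (h : Derives T Γ φ) : Derives T Γ (φ ⋎ ψ)
  | orI₂ {n : ℕ} {Γ : List (Form L n)} {φ ψ : Form L n} (h : Derives T Γ ψ) : Derives T Γ (φ ⋎ ψ)
  | orE {n : ℕ} {Γ : List (Form L n)} {φ ψ χ : Form L n} (h : Derives T Γ (φ ⋎ ψ))
      (h₁ : Derives T (φ :: Γ) χ) (h₂ : Derives T (ψ :: Γ) χ) : Derives T Γ χ
  | impI {n : ℕ} {Γ : List (Form L n)} {φ ψ : Form L n} (h : Derives T (φ :: Γ) ψ) :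
      Derives T Γ (φ ⇛ ψ)
  | impE {n : ℕ} {Γ : List (Form L n)} {φ ψ : Form L n} (h₁ : Derives T Γ (φ ⇛ ψ))
      (h₂ : Derives T Γ φ) : Derives T Γ ψ
  | allI {n : ℕ} {Γ : List (Form L n)} {φ : Form L (n + 1)}
      (h : Derives T (Γ.map Form.weaken) φ) : Derives T Γ (Form.all φ)
  | allE {n : ℕ} {Γ : List (Form L n)} {φ : Form L (n + 1)} (h : Derives T Γ (Form.all φ))
      (t : L.Term (Fin n)) : Derives T Γ (φ.inst t)
  | exI {n : ℕ} {Γ : List (Form L n)} {φ : Form L (n + 1)} (t : L.Term (Fin n))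
      (h : Derives T Γ (φ.inst t)) : Derives T Γ (Form.ex φ)
  | exE {n : ℕ} {Γ : List (Form L n)} {φ : Form L (n + 1)} {ψ : Form L n}
      (h₁ : Derives T Γ (Form.ex φ)) (h₂ : Derives T (φ :: Γ.map Form.weaken) ψ.weaken) :
      Derives T Γ ψ
  | eqRefl {n : ℕ} {Γ : List (Form L n)} (t : L.Term (Fin n)) : Derives T Γ (t ≐ t)
  | eqSubst {n : ℕ} {Γ : List (Form L n)} (φ : Form L (n + 1)) {s t : L.Term (Fin n)}
      (h₁ : Derives T Γ (s ≐ t)) (h₂ : Derives T Γ (φ.inst s)) : Derives T Γ (φ.inst t)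
  | nonempty {n : ℕ} {Γ : List (Form L n)} : Derives T Γ
      (Form.ex (FirstOrder.Language.Term.var (Fin.last n) ≐ FirstOrder.Language.Term.var (Fin.last n)))

/-- The sentence `φ` is intuitionistically provable in the theory `T`. -/
def Proves {L : FirstOrder.Language.{0, 0}} (T : Set (Form L 0)) (φ : Form L 0) : Prop := Derives T [] φ

/-! ### The language of geometry

One sort, the points; strict betweenness and equidistance. Lines are given by two distinct points,
circles by a center and a radius segment. -/

inductive GeoRel : ℕ → Type
  | bet : GeoRel 3
  | cong : GeoRel 4

abbrev geo : FirstOrder.Language.{0, 0} := ⟨fun _ => Empty, GeoRel⟩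

section Geometry

variable {n : ℕ}

/-- The points `a` and `b` are equal. -/
def eqPt (a b : Fin n) : Form geo n := FirstOrder.Language.Term.var a ≐ FirstOrder.Language.Term.var b

/-- The points `a` and `b` are distinct. -/
def ne (a b : Fin n) : Form geo n := (eqPt a b).neg

/-- `b` is strictly between `a` and `c`. -/
def bet (a b c : Fin n) : Form geo n :=
  Form.rel (L := geo) GeoRel.bet fun i => FirstOrder.Language.Term.var (![a, b, c] i)

/-- The segments `ab` and `cd` are congruent. -/
def cong (a b c d : Fin n) : Form geo n :=
  Form.rel (L := geo) GeoRel.cong fun i => FirstOrder.Language.Term.var (![a, b, c, d] i)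

/-- `b` is non-strictly between `a` and `c`. -/
def betT (a b c : Fin n) : Form geo n := (ne a b ⋏ ne b c ⋏ (bet a b c).neg).neg

/-- `x` lies on the line through the two distinct points `a` and `b`. -/
def on (x a b : Fin n) : Form geo n :=
  (bet a b x ⋎ bet b x a ⋎ bet x a b ⋎ eqPt x a ⋎ eqPt x b).neg.neg

/-- `a`, `b`, `c` are not collinear. -/
def nonCol (a b c : Fin n) : Form geo n := ne a b ⋏ (on c a b).neg

/-- `ab ≤ cd`: some point `e` of the closed segment `cd` has `ab = ce`. -/
def segLe (a b c d : Fin n) : Form geo n :=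
  Form.ex (betT c.castSucc (Fin.last n) d.castSucc ⋏
    cong a.castSucc b.castSucc c.castSucc (Fin.last n))

/-- The line through `k₁, k₂` and the line through `l₁, l₂` have no common point. -/
def parallel (k₁ k₂ l₁ l₂ : Fin n) : Form geo n :=
  Form.all (on (Fin.last n) k₁.castSucc k₂.castSucc ⋏
    on (Fin.last n) l₁.castSucc l₂.castSucc).neg

/-- The line through `k₁, k₂` and the line through `l₁, l₂` have a common point. -/
def meet (k₁ k₂ l₁ l₂ : Fin n) : Form geo n :=
  Form.ex (on (Fin.last n) k₁.castSucc k₂.castSucc ⋏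
    on (Fin.last n) l₁.castSucc l₂.castSucc)

end Geometry

/-! ### Neutral constructive geometry

In each closed formula the variables `0, 1, 2, …` stand for the points listed in its comment. -/

/-- The principles of plane neutral constructive geometry: stability, betweenness, congruence,
extension of non-null segments, inner Pasch, dimension two, line-circle and circle-circle
continuity. There is no parallel postulate. -/
inductive NeutralAxiom : Form geo 0 → Prop
  /- stability of equality, betweenness and congruence -/
  | eq_stable : NeutralAxiom (Form.close (n := 2) ((ne 0 1).neg ⇛ eqPt 0 1))
  | bet_stable : NeutralAxiom (Form.close (n := 3) ((bet 0 1 2).neg.neg ⇛ bet 0 1 2))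
  | cong_stable : NeutralAxiom (Form.close (n := 4) ((cong 0 1 2 3).neg.neg ⇛ cong 0 1 2 3))
  /- betweenness is strict and symmetric -/
  | bet_ne : NeutralAxiom (Form.close (n := 3) (bet 0 1 2 ⇛ ne 0 1 ⋏ ne 1 2 ⋏ ne 0 2))
  | bet_symm : NeutralAxiom (Form.close (n := 3) (bet 0 1 2 ⇛ bet 2 1 0))
  /- outer transitivity, inner transitivity, transitivity, comparability; `a, b, c, d` -/
  | bet_outer : NeutralAxiom (Form.close (n := 4)
      (betT 0 1 2 ⋏ betT 1 2 3 ⋏ ne 1 2 ⇛ betT 0 2 3 ⋏ betT 0 1 3))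
  | bet_inner : NeutralAxiom (Form.close (n := 4)
      (betT 0 1 3 ⋏ betT 1 2 3 ⇛ betT 0 1 2 ⋏ betT 0 2 3))
  | bet_trans : NeutralAxiom (Form.close (n := 4)
      (betT 0 1 2 ⋏ betT 0 2 3 ⇛ betT 1 2 3 ⋏ betT 0 1 3))
  | bet_comparable : NeutralAxiom (Form.close (n := 4)
      (bet 0 1 2 ⋏ bet 0 1 3 ⋏ (betT 0 2 3).neg ⇛ betT 0 3 2))
  /- congruence -/
  | cong_swap : NeutralAxiom (Form.close (n := 2) (cong 0 1 1 0))
  | cong_trans : NeutralAxiom (Form.close (n := 6)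
      (cong 0 1 2 3 ⋏ cong 0 1 4 5 ⇛ cong 2 3 4 5))
  | cong_null : NeutralAxiom (Form.close (n := 3) (cong 0 1 2 2 ⇛ eqPt 0 1))
  /- five segments; `a, b, c, d, a', b', c', d'` -/
  | five_segment : NeutralAxiom (Form.close (n := 8)
      (ne 0 1 ⋏ betT 0 1 2 ⋏ betT 4 5 6 ⋏ cong 0 1 4 5 ⋏ cong 1 2 5 6 ⋏ cong 0 3 4 7 ⋏
        cong 1 3 5 7 ⇛ cong 2 3 6 7))
  /- extension of the non-null segment `ab` by `cd`; `a, b, c, d` and the new point `4` -/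
  | extension : NeutralAxiom (Form.close (n := 4)
      (ne 0 1 ⇛ Form.ex (betT 0 1 4 ⋏ cong 1 4 2 3)))
  /- inner Pasch; `a, b, c, p, q` and the new point `5` -/
  | inner_pasch : NeutralAxiom (Form.close (n := 5)
      (nonCol 0 1 2 ⋏ bet 0 3 2 ⋏ bet 1 4 2 ⇛ Form.ex (bet 3 5 1 ⋏ bet 4 5 0)))
  /- lower dimension: three non-collinear points exist -/
  | lower_dim : NeutralAxiom (Form.ex (Form.ex (Form.ex (nonCol 0 1 2))))
  /- upper dimension: points equidistant from `a ≠ b` are collinear; `a, b, x, y, z` -/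
  | upper_dim : NeutralAxiom (Form.close (n := 5)
      (ne 0 1 ⋏ cong 2 0 2 1 ⋏ cong 3 0 3 1 ⋏ cong 4 0 4 1 ⋏ ne 2 3 ⇛ on 4 2 3))
  /- line-circle continuity, for the circle with center `c` through `d`, a point `a` non-strictly
  inside and a point `b` non-strictly outside; `a, b, c, d` and the new point `4` -/
  | line_circle : NeutralAxiom (Form.close (n := 4)
      (ne 0 1 ⋏ segLe 2 0 2 3 ⋏ segLe 2 3 2 1 ⇛ Form.ex (betT 0 4 1 ⋏ cong 2 4 2 3)))
  /- circle-circle continuity, for the circle with center `a` through `p` and the circle with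
  center `b ≠ a` through `d`: the points `p` and `q` of the first circle are non-strictly inside
  and non-strictly outside the second one; `a, b, d, p, q` and the new point `5` -/
  | circle_circle : NeutralAxiom (Form.close (n := 5)
      (ne 0 1 ⋏ cong 0 3 0 4 ⋏ segLe 1 3 1 2 ⋏ segLe 1 2 1 4 ⇛
        Form.ex (cong 0 5 0 3 ⋏ cong 1 5 1 2)))

/-- `T` is a theory of neutral constructive geometry: it proves (possibly as axioms) the principles
of neutral constructive geometry. It may have any further axioms. -/
def IsNeutralTheory (T : Set (Form geo 0)) : Prop := ∀ φ, NeutralAxiom φ → Proves T φ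

/-! ### Parallel postulates and circumscription principles -/

/-- Playfair: if the lines `K = k₁k₂` and `M = m₁m₂` through `p` are both parallel to `L = l₁l₂`,
then `q` is on `K` if and only if it is on `M`. -/
def playfairAt {n : ℕ} (k₁ k₂ l₁ l₂ m₁ m₂ p q : Fin n) : Form geo n :=
  ne k₁ k₂ ⋏ ne l₁ l₂ ⋏ ne m₁ m₂ ⋏ parallel k₁ k₂ l₁ l₂ ⋏ parallel m₁ m₂ l₁ l₂ ⋏
    on p k₁ k₂ ⋏ on p m₁ m₂ ⇛ (on q k₁ k₂).iff (on q m₁ m₂)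

def playfair : Form geo 0 := Form.close (playfairAt (n := 8) 0 1 2 3 4 5 6 7)

/-- Strong parallel postulate, with `L = Line(s, q)`, `M = Line(p, a)`, `K = Line(p, r)`. -/
def strongParallelAt {n : ℕ} (p q r s t a : Fin n) : Form geo n :=
  bet p t q ⋏ bet s t r ⋏ ne s q ⋏ (on p s q).neg ⋏ ne p r ⋏ ne p a ⋏ (on a p r).neg ⋏
    cong p t q t ⋏ cong r t s t ⇛ meet s q p a

def strongParallel : Form geo 0 := Form.close (strongParallelAt (n := 6) 0 1 2 3 4 5)

/-- Euclid 5, with `L = Line(s, q)`, `M = Line(p, a)`: the lines `L` and `M` meet in a point `e`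
such that `a` is between `p` and `e`, and `q` is between `s` and `e`. -/
def euclid5At {n : ℕ} (p q r s t a : Fin n) : Form geo n :=
  bet q a r ⋏ bet p t q ⋏ bet s t r ⋏ cong p t q t ⋏ cong r t s t ⋏ ne p r ⋏ ne s q ⋏ ne p a ⋏
    (on p s q).neg ⇛
    Form.ex (on (Fin.last n) s.castSucc q.castSucc ⋏ on (Fin.last n) p.castSucc a.castSucc ⋏
      bet p.castSucc a.castSucc (Fin.last n) ⋏ bet s.castSucc q.castSucc (Fin.last n))

def euclid5 : Form geo 0 := Form.close (euclid5At (n := 6) 0 1 2 3 4 5)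

/-- Some point is equidistant from `a`, `b` and `c`. -/
def hasCenter {n : ℕ} (a b c : Fin n) : Form geo n :=
  Form.ex (cong (Fin.last n) a.castSucc (Fin.last n) b.castSucc ⋏
    cong (Fin.last n) a.castSucc (Fin.last n) c.castSucc)

/-- Triangle circumscription: non-collinear points `a`, `b`, `c` lie on a circle. -/
def triangleCircumscription : Form geo 0 :=
  Form.close (n := 3) (nonCol 0 1 2 ⇛ hasCenter 0 1 2)

/-- The non-uniform version: any three points lie on a circle, unless they are distinct and
collinear. -/
def nonuniformCircumscription : Form geo 0 :=
  Form.close (n := 3)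
    ((ne 0 1 ⋏ ne 1 2 ⋏ ne 0 2 ⋏ on 2 0 1).neg ⇛ hasCenter 0 1 2)

/-- Some point `e` is equidistant from `a`, `b` and `c` and, if `a = b`, then the circle with center
`e` through `a` has no other point on the line `L = uv` (it is tangent to `L` at `a`). -/
def hasStrongCenter {n : ℕ} (u v a b c : Fin n) : Form geo n :=
  Form.ex (cong (Fin.last n) a.castSucc (Fin.last n) b.castSucc ⋏
    cong (Fin.last n) a.castSucc (Fin.last n) c.castSucc ⋏
    (eqPt a.castSucc b.castSucc ⇛
      Form.all (on (Fin.last (n + 1)) u.castSucc.castSucc v.castSucc.castSucc ⋏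
        cong (Fin.last n).castSucc (Fin.last (n + 1)) (Fin.last n).castSucc a.castSucc.castSucc ⇛
        eqPt (Fin.last (n + 1)) a.castSucc.castSucc)))

/-- Strong triangle circumscription: for `a`, `b` on the line `L = uv` and `c` not on `L`. -/
def strongCircumscriptionAt {n : ℕ} (u v a b c : Fin n) : Form geo n :=
  ne u v ⋏ on a u v ⋏ on b u v ⋏ (on c u v).neg ⇛ hasStrongCenter u v a b c

def strongCircumscription : Form geo 0 :=
  Form.close (strongCircumscriptionAt (n := 5) 0 1 2 3 4)

/-- One-sided triangle circumscription: as before, but `a` and `b` are in addition assumed not to lie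
on opposite sides of the perpendicular `W = cf` from `c` to `L = uv`. The point `f` of `L` is the
foot of this perpendicular, as witnessed by points `g`, `h` of `L`. -/
def oneSidedCircumscriptionAt {n : ℕ} (u v a b c f g h : Fin n) : Form geo n :=
  ne u v ⋏ on a u v ⋏ on b u v ⋏ (on c u v).neg ⋏
    on f u v ⋏ on g u v ⋏ on h u v ⋏ bet g f h ⋏ cong g f f h ⋏ cong c g c h ⋏
    (Form.ex (on (Fin.last n) c.castSucc f.castSucc ⋏
      bet a.castSucc (Fin.last n) b.castSucc)).neg ⇛ hasStrongCenter u v a b c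

def oneSidedCircumscription : Form geo 0 :=
  Form.close (oneSidedCircumscriptionAt (n := 8) 0 1 2 3 4 5 6 7)

/-! ### Playfair rings -/

inductive FieldFun : ℕ → Type
  | zero : FieldFun 0
  | one : FieldFun 0
  | neg : FieldFun 1
  | add : FieldFun 2
  | mul : FieldFun 2

/-- The predicate "is positive". -/
inductive FieldRel : ℕ → Type
  | pos : FieldRel 1

/-- The language of ordered rings: `0, 1, -, +, ·` and the predicate `P`. -/
abbrev fld : FirstOrder.Language.{0, 0} := ⟨FieldFun, FieldRel⟩

section Rings

variable {n : ℕ}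

instance : Zero (fld.Term (Fin n)) := ⟨FirstOrder.Language.Term.func (L := fld) FieldFun.zero ![]⟩
instance : One (fld.Term (Fin n)) := ⟨FirstOrder.Language.Term.func (L := fld) FieldFun.one ![]⟩
instance : Neg (fld.Term (Fin n)) := ⟨fun s => FirstOrder.Language.Term.func (L := fld) FieldFun.neg ![s]⟩
instance : Add (fld.Term (Fin n)) := ⟨fun s t => FirstOrder.Language.Term.func (L := fld) FieldFun.add ![s, t]⟩
instance : Mul (fld.Term (Fin n)) := ⟨fun s t => FirstOrder.Language.Term.func (L := fld) FieldFun.mul ![s, t]⟩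
instance : Sub (fld.Term (Fin n)) := ⟨fun s t => s + -t⟩

/-- The `i`-th variable, as a term. -/
def v (i : Fin n) : fld.Term (Fin n) := FirstOrder.Language.Term.var i

/-- `t` is positive. -/
def pos (t : fld.Term (Fin n)) : Form fld n := Form.rel (L := fld) FieldRel.pos ![t]

/-- `s ≤ t`, that is, not `t < s`, where `t < s` means that `s - t` is positive. -/
def le (s t : fld.Term (Fin n)) : Form fld n := (pos (s - t)).neg

/-- `u = |a|`: the element `u` is the non-negative square root of `a²`. -/
def isAbs (u a : fld.Term (Fin n)) : Form fld n := le 0 u ⋏ (u * u ≐ a * a)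

end Rings

/-- The axioms of Playfair rings. -/
inductive PlayfairRingAxiom : Form fld 0 → Prop
  /- commutative rings -/
  | add_assoc : PlayfairRingAxiom (Form.close (n := 3) (v 0 + v 1 + v 2 ≐ v 0 + (v 1 + v 2)))
  | add_comm : PlayfairRingAxiom (Form.close (n := 2) (v 0 + v 1 ≐ v 1 + v 0))
  | add_zero : PlayfairRingAxiom (Form.close (n := 1) (v 0 + 0 ≐ v 0))
  | add_neg : PlayfairRingAxiom (Form.close (n := 1) (v 0 + -v 0 ≐ 0))
  | mul_assoc : PlayfairRingAxiom (Form.close (n := 3) (v 0 * v 1 * v 2 ≐ v 0 * (v 1 * v 2)))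
  | mul_comm : PlayfairRingAxiom (Form.close (n := 2) (v 0 * v 1 ≐ v 1 * v 0))
  | mul_one : PlayfairRingAxiom (Form.close (n := 1) (v 0 * 1 ≐ v 0))
  | mul_add : PlayfairRingAxiom (Form.close (n := 3) (v 0 * (v 1 + v 2) ≐ v 0 * v 1 + v 0 * v 2))
  /- stability of equality -/
  | eq_stable : PlayfairRingAxiom (Form.close (n := 2) ((v 0 ≐ v 1).neg.neg ⇛ v 0 ≐ v 1))
  /- `0 ≠ 1` -/
  | zero_ne_one : PlayfairRingAxiom ((0 ≐ 1 : Form fld 0).neg)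
  /- sums and products of positive elements are positive -/
  | pos_add_mul : PlayfairRingAxiom (Form.close (n := 2)
      (pos (v 0) ⋏ pos (v 1) ⇛ pos (v 0 + v 1) ⋏ pos (v 0 * v 1)))
  /- not both `x` and `-x` are positive; if neither of them is positive, then `x = 0` -/
  | pos_asymm : PlayfairRingAxiom (Form.close (n := 2)
      (v 0 + v 1 ≐ 0 ⇛ (pos (v 0) ⋏ pos (v 1)).neg))
  | eq_zero : PlayfairRingAxiom (Form.close (n := 2)
      ((v 0 + v 1 ≐ 0) ⋏ (pos (v 0)).neg ⋏ (pos (v 1)).neg ⇛ v 0 ≐ 0))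
  /- non-negative elements `x` have non-negative square roots -/
  | sqrt : PlayfairRingAxiom (Form.close (n := 2)
      ((v 0 + v 1 ≐ 0) ⋏ (pos (v 1)).neg ⇛ Form.ex (le 0 (v 2) ⋏ (v 2 * v 2 ≐ v 0))))
  /- Markov's principle -/
  | markov : PlayfairRingAxiom (Form.close (n := 1) ((pos (v 0)).neg.neg ⇛ pos (v 0)))
  /- elements without reciprocals are zero -/
  | no_inverse : PlayfairRingAxiom (Form.close (n := 1)
      (Form.all (v 0 * v 1 ≐ 1).neg ⇛ v 0 ≐ 0))
  /- bounded quotients exist: if `|a| ≤ |b| y` then `a = b z` for some `z`. The variables are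
  `a, b, y, |a|, |b|` and the new element `5` -/
  | bounded_quotient : PlayfairRingAxiom (Form.close (n := 5)
      (isAbs (v 3) (v 0) ⋏ isAbs (v 4) (v 1) ⋏ le (v 3) (v 4 * v 2) ⇛
        Form.ex (v 0 ≐ v 1 * v 5)))

/-- The theory of Playfair rings. -/
def playfairRings : Set (Form fld 0) := {φ | PlayfairRingAxiom φ}

/-! ### Analytic geometry -/

/-- Terms of the language of geometry are variables. -/
def geoVar {n : ℕ} : geo.Term (Fin n) → Fin n
  | .var i => i
  | .func f _ => nomatch f

/-- The two coordinates of the point variable `i` are the ring variables `2i` and `2i + 1`. -/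
def cx {n : ℕ} (i : Fin n) : fld.Term (Fin (2 * n)) := v ⟨2 * i, by omega⟩

def cy {n : ℕ} (i : Fin n) : fld.Term (Fin (2 * n)) := v ⟨2 * i + 1, by omega⟩

/-- Strict betweenness: `(c - b) × (b - a) = 0` and `(b - c) · (a - b) > 0`.
Equidistance: `(b - a)² = (d - c)²`. -/
def barRel {n : ℕ} : {l : ℕ} → GeoRel l → (Fin l → Fin n) → Form fld (2 * n)
  | _, .bet, p =>
      let a := p 0
      let b := p 1
      let c := p 2
      ((cx c - cx b) * (cy b - cy a) - (cy c - cy b) * (cx b - cx a) ≐ 0) ⋏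
        pos ((cx b - cx c) * (cx a - cx b) + (cy b - cy c) * (cy a - cy b))
  | _, .cong, p =>
      let a := p 0
      let b := p 1
      let c := p 2
      let d := p 3
      (cx b - cx a) * (cx b - cx a) + (cy b - cy a) * (cy b - cy a) ≐
        (cx d - cx c) * (cx d - cx c) + (cy d - cy c) * (cy d - cy c)

/-- The analytic-geometry interpretation of geometry in the language of ordered rings: a quantifier
over points becomes two quantifiers over ring elements, and the logical connectives are kept. -/
def bar : {n : ℕ} → Form geo n → Form fld (2 * n)
  | _, .falsum => .falsum
  | _, .equal s t => (cx (geoVar s) ≐ cx (geoVar t)) ⋏ (cy (geoVar s) ≐ cy (geoVar t))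
  | _, .rel R ts => barRel R fun i => geoVar (ts i)
  | _, .and φ ψ => bar φ ⋏ bar ψ
  | _, .or φ ψ => bar φ ⋎ bar ψ
  | _, .imp φ ψ => bar φ ⇛ bar ψ
  | _, .all φ => .all (.all (bar φ))
  | _, .ex φ => .ex (.ex (bar φ))

/-- The analytic-geometry interpretation is sound from `T` to the theory of Playfair rings: the
interpretations of the axioms of `T` (hence of all theorems of `T`) are provable in that theory. -/
def SoundInPlayfairRings (T : Set (Form geo 0)) : Prop := ∀ φ ∈ T, Proves playfairRings (bar φ)

end ConstructiveGeometry

open ConstructiveGeometry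

/-! The unprovability results come from one Kripke model with two nodes. At the top stands the plane
over a Euclidean ordered field `F` with an infinitesimal `ε`, concretely the hyperreals; at the root
stands its subplane of points with finite coordinates, with the same atomic relations. The finite
elements below `F` force every Playfair ring axiom (`force_playfairRings`): square roots and bounded
quotients of finite elements are finite, and an element with no inverse even at the top is zero.
Forcing commutes with the analytic interpretation (`force_bar`), so by soundness (`Derives.force`)
the finite plane forces all axioms of `T`. It also forces Playfair's axiom (`Playfair.force`):
incidence is a negated formula and is decided at the top, where the plane over a field satisfies
Playfair. The existence principles fail at the root, because the point they ask for exists only at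
infinite distance. A line of slope `-ε` through `(0, 1)` meets the `x`-axis at `1 / ε`, and the
points `(1, 0)`, `(2, 0)`, `(0, ε)` have an infinitely distant circumcenter.

For the provable implication, the geometry is done classically: reflecting a point of `L` in the
midpoint of a segment from `p` to `L` gives a line through `p`, and under the strong parallel
postulate every parallel to `L` through `p` must be that line
(`Neutral.playfair_of_strongParallel`). The argument is transferred to intuitionistic logic
semantically. Playfair's conclusion is doubly negated, so it suffices to derive a contradiction from
a counterexample. If none were derivable, `exists_model` would give a classical model of the
assumptions. That model is built from a generic ideal of consistent finite contexts deciding every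
formula. Intuitionistically a refuted universal formula need not have a counterexample, so truth of
universal formulas transfers in one direction only. This is enough, because the axioms used, the
postulate and the assumptions all belong to the class `Form.PosAll`, where that direction suffices.
-/

namespace ConstructiveGeometry

open FirstOrder.Language (Term)

/-! ### Substitution in terms and formulas -/

namespace Form

variable {L : FirstOrder.Language.{0, 0}}

theorem subst_var_term {α : Type} (t : L.Term α) : t.subst Term.var = t := by
  induction t with
  | var => rfl
  | func f ts ih => simp [Term.subst, ih]

theorem subst_subst_term {α β γ : Type} (t : L.Term α) (σ : α → L.Term β) (τ : β → L.Term γ) :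
    (t.subst σ).subst τ = t.subst fun i => (σ i).subst τ := by
  induction t with
  | var => rfl
  | func f ts ih => simp [Term.subst, ih]

theorem relabel_eq_subst {α β : Type} (t : L.Term α) (g : α → β) :
    t.relabel g = t.subst fun i => Term.var (g i) := by
  induction t with
  | var => rfl
  | func f ts ih => simp [Term.subst, Term.relabel, ih]

@[simp] theorem liftSubst_castSucc {n m : ℕ} (σ : Fin n → L.Term (Fin m)) (i : Fin n) :
    liftSubst σ i.castSucc = (σ i).relabel Fin.castSucc := by
  simp [liftSubst]

@[simp] theorem liftSubst_last {n m : ℕ} (σ : Fin n → L.Term (Fin m)) :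
    liftSubst σ (Fin.last n) = Term.var (Fin.last m) := by
  simp [liftSubst]

theorem liftSubst_var {n : ℕ} : liftSubst (L := L) (Term.var (α := Fin n)) = Term.var := by
  funext i
  refine Fin.lastCases ?_ (fun i => ?_) i <;> simp [Term.relabel]

theorem liftSubst_liftSubst {n m k : ℕ} (σ : Fin n → L.Term (Fin m)) (τ : Fin m → L.Term (Fin k)) :
    (fun i => (liftSubst σ i).subst (liftSubst τ)) = liftSubst fun i => (σ i).subst τ := by
  funext i
  refine Fin.lastCases ?_ (fun i => ?_) i
  · simp [Term.subst]
  · simp [relabel_eq_subst, subst_subst_term, Term.subst]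

theorem subst_var {n : ℕ} (φ : Form L n) : φ.subst Term.var = φ := by
  induction φ with
  | falsum => rfl
  | equal s t => simp [subst, subst_var_term]
  | rel R ts => simp [subst, subst_var_term]
  | and φ ψ h₁ h₂ => simp [subst, h₁, h₂]
  | or φ ψ h₁ h₂ => simp [subst, h₁, h₂]
  | imp φ ψ h₁ h₂ => simp [subst, h₁, h₂]
  | all φ h => simp [subst, liftSubst_var, h]
  | ex φ h => simp [subst, liftSubst_var, h]

theorem subst_subst {n : ℕ} (φ : Form L n) :
    ∀ {m k : ℕ} (σ : Fin n → L.Term (Fin m)) (τ : Fin m → L.Term (Fin k)),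
      (φ.subst σ).subst τ = φ.subst fun i => (σ i).subst τ := by
  induction φ with
  | falsum => intros; rfl
  | equal s t => simp [subst, subst_subst_term]
  | rel R ts => simp [subst, subst_subst_term]
  | and φ ψ h₁ h₂ => simp [subst, h₁, h₂]
  | or φ ψ h₁ h₂ => simp [subst, h₁, h₂]
  | imp φ ψ h₁ h₂ => simp [subst, h₁, h₂]
  | all φ h => intros; simp [subst, h, liftSubst_liftSubst]
  | ex φ h => intros; simp [subst, h, liftSubst_liftSubst]

theorem weaken_subst_liftSubst {n m : ℕ} (φ : Form L n) (σ : Fin n → L.Term (Fin m)) :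
    φ.weaken.subst (liftSubst σ) = (φ.subst σ).weaken := by
  simp [weaken, subst_subst, Term.subst, relabel_eq_subst]

theorem inst_subst {n m : ℕ} (φ : Form L (n + 1)) (t : L.Term (Fin n))
    (σ : Fin n → L.Term (Fin m)) :
    (φ.inst t).subst σ = (φ.subst (liftSubst σ)).inst (t.subst σ) := by
  rw [inst, inst, subst_subst, subst_subst]
  congr 1
  funext i
  refine Fin.lastCases ?_ (fun i => ?_) i
  · simp [Term.subst]
  · simp [relabel_eq_subst, subst_subst_term, Term.subst, subst_var_term]

theorem subst_inst_liftSubst {n m : ℕ} (φ : Form L (n + 1)) (σ : Fin n → L.Term (Fin m))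
    (t : L.Term (Fin m)) :
    (φ.subst (liftSubst σ)).inst t = φ.subst (Fin.snoc (α := fun _ => L.Term (Fin m)) σ t) := by
  rw [inst, subst_subst]
  congr 1
  funext i
  refine Fin.lastCases ?_ (fun i => ?_) i
  · simp [Term.subst]
  · simp [relabel_eq_subst, subst_subst_term, Term.subst, subst_var_term]

theorem ofSentence_subst {n m : ℕ} (φ : Form L 0) (σ : Fin n → L.Term (Fin m)) :
    (φ.ofSentence n).subst σ = φ.ofSentence m := by
  rw [ofSentence, ofSentence, subst_subst]
  congr 1
  funext i
  exact i.elim0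

theorem ofSentence_zero (φ : Form L 0) : φ.ofSentence 0 = φ := by
  conv_rhs => rw [← subst_var φ]
  rw [ofSentence]
  congr 1
  funext i
  exact i.elim0

end Form

/-! ### Weakening, substitution and equality in derivations -/

namespace Derives

variable {L : FirstOrder.Language.{0, 0}} {T : Set (Form L 0)}

theorem weakening {n : ℕ} {Γ : List (Form L n)} {φ : Form L n} (h : Derives T Γ φ) :
    ∀ {Δ : List (Form L n)}, Γ ⊆ Δ → Derives T Δ φ := by
  induction h with
  | ax h => intros; exact .ax h
  | hyp h => intro Δ hΔ; exact .hyp (hΔ h)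
  | falsumE _ ih => intro Δ hΔ; exact .falsumE (ih hΔ)
  | andI _ _ ih₁ ih₂ => intro Δ hΔ; exact .andI (ih₁ hΔ) (ih₂ hΔ)
  | andE₁ _ ih => intro Δ hΔ; exact .andE₁ (ih hΔ)
  | andE₂ _ ih => intro Δ hΔ; exact .andE₂ (ih hΔ)
  | orI₁ _ ih => intro Δ hΔ; exact .orI₁ (ih hΔ)
  | orI₂ _ ih => intro Δ hΔ; exact .orI₂ (ih hΔ)
  | orE _ _ _ ih ih₁ ih₂ =>
    intro Δ hΔ
    exact .orE (ih hΔ) (ih₁ (List.cons_subset_cons _ hΔ)) (ih₂ (List.cons_subset_cons _ hΔ))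
  | impI _ ih => intro Δ hΔ; exact .impI (ih (List.cons_subset_cons _ hΔ))
  | impE _ _ ih₁ ih₂ => intro Δ hΔ; exact .impE (ih₁ hΔ) (ih₂ hΔ)
  | allI _ ih => intro Δ hΔ; exact .allI (ih (List.map_subset _ hΔ))
  | allE _ t ih => intro Δ hΔ; exact .allE (ih hΔ) t
  | exI t _ ih => intro Δ hΔ; exact .exI t (ih hΔ)
  | exE _ _ ih₁ ih₂ =>
    intro Δ hΔ
    exact .exE (ih₁ hΔ) (ih₂ (List.cons_subset_cons _ (List.map_subset _ hΔ)))
  | eqRefl t => intros; exact .eqRefl t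
  | eqSubst φ _ _ ih₁ ih₂ => intro Δ hΔ; exact .eqSubst φ (ih₁ hΔ) (ih₂ hΔ)
  | nonempty => intros; exact .nonempty

theorem map_weaken_subst {n m : ℕ} (Γ : List (Form L n)) (σ : Fin n → L.Term (Fin m)) :
    (Γ.map Form.weaken).map (fun γ => γ.subst (Form.liftSubst σ)) =
      (Γ.map fun γ => γ.subst σ).map Form.weaken := by
  simp [Form.weaken_subst_liftSubst]

theorem subst {n : ℕ} {Γ : List (Form L n)} {φ : Form L n} (h : Derives T Γ φ) :
    ∀ {m : ℕ} (σ : Fin n → L.Term (Fin m)),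
      Derives T (Γ.map fun γ => γ.subst σ) (φ.subst σ) := by
  induction h with
  | ax h => intro m σ; rw [Form.ofSentence_subst]; exact .ax h
  | hyp h => intro m σ; exact .hyp (List.mem_map_of_mem h)
  | falsumE _ ih => intro m σ; exact .falsumE (ih σ)
  | andI _ _ ih₁ ih₂ => intro m σ; exact .andI (ih₁ σ) (ih₂ σ)
  | andE₁ _ ih => intro m σ; exact .andE₁ (ih σ)
  | andE₂ _ ih => intro m σ; exact .andE₂ (ih σ)
  | orI₁ _ ih => intro m σ; exact .orI₁ (ih σ)
  | orI₂ _ ih => intro m σ; exact .orI₂ (ih σ)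
  | orE _ _ _ ih ih₁ ih₂ => intro m σ; exact .orE (ih σ) (ih₁ σ) (ih₂ σ)
  | impI _ ih => intro m σ; exact .impI (ih σ)
  | impE _ _ ih₁ ih₂ => intro m σ; exact .impE (ih₁ σ) (ih₂ σ)
  | allI _ ih =>
    intro m σ
    refine .allI ?_
    rw [← map_weaken_subst]
    exact ih _
  | allE _ t ih => intro m σ; rw [Form.inst_subst]; exact .allE (ih σ) _
  | exI t _ ih =>
    intro m σ
    refine .exI (t.subst σ) ?_
    rw [← Form.inst_subst]
    exact ih σ
  | exE _ _ ih₁ ih₂ =>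
    intro m σ
    refine .exE (ih₁ σ) ?_
    rw [← map_weaken_subst, ← Form.weaken_subst_liftSubst]
    exact ih₂ _
  | eqRefl t => intros; exact .eqRefl _
  | @eqSubst _ _ φ s t _ _ ih₁ ih₂ =>
    intro m σ
    rw [Form.inst_subst]
    refine .eqSubst _ (s := s.subst σ) (ih₁ σ) ?_
    rw [← Form.inst_subst]
    exact ih₂ σ
  | @nonempty n Γ =>
    intro m σ
    have : ∀ σ : Fin n → L.Term (Fin m), (Form.ex (Term.var (Fin.last n) ≐ Term.var (Fin.last n))).subst σ =
        Form.ex (Term.var (Fin.last m) ≐ Term.var (Fin.last m)) := by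
      intro σ
      simp [Form.subst, Term.subst]
    rw [this]
    exact .nonempty

/-- Leibniz's rule for the property "`x` equals `s`", which `s` has by reflexivity. -/
theorem eqSymm {n : ℕ} {Γ : List (Form L n)} {s t : L.Term (Fin n)} (h : Derives T Γ (s ≐ t)) :
    Derives T Γ (t ≐ s) := by
  have := eqSubst (Term.var (Fin.last n) ≐ s.relabel Fin.castSucc) h
  simp only [Form.inst, Form.subst, Form.relabel_eq_subst, Form.subst_subst_term, Term.subst,
    Fin.snoc_last, Fin.snoc_castSucc, Form.subst_var_term] at this
  exact this (.eqRefl s)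

theorem eqTrans {n : ℕ} {Γ : List (Form L n)} {s t r : L.Term (Fin n)} (h : Derives T Γ (s ≐ t))
    (h' : Derives T Γ (t ≐ r)) : Derives T Γ (s ≐ r) := by
  have := eqSubst (s.relabel Fin.castSucc ≐ Term.var (Fin.last n)) h'
  simp only [Form.inst, Form.subst, Form.relabel_eq_subst, Form.subst_subst_term, Term.subst,
    Fin.snoc_last, Fin.snoc_castSucc, Form.subst_var_term] at this
  exact this h

end Derives

/-! ### Truth in a structure, and forcing in a two-node Kripke model -/

namespace Form

variable {L : FirstOrder.Language.{0, 0}} {M : Type} [L.Structure M]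

/-- Truth of a formula in a structure. -/
def Realize : {n : ℕ} → Form L n → (Fin n → M) → Prop
  | _, falsum, _ => False
  | _, equal s t, v => s.realize v = t.realize v
  | _, rel R ts, v => FirstOrder.Language.Structure.RelMap R fun i => (ts i).realize v
  | _, and φ ψ, v => φ.Realize v ∧ ψ.Realize v
  | _, or φ ψ, v => φ.Realize v ∨ ψ.Realize v
  | _, imp φ ψ, v => φ.Realize v → ψ.Realize v
  | n, all φ, v => ∀ x : M, φ.Realize (Fin.snoc (α := fun _ : Fin (n + 1) => M) v x)
  | n, ex φ, v => ∃ x : M, φ.Realize (Fin.snoc (α := fun _ : Fin (n + 1) => M) v x)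

theorem realize_neg {n : ℕ} (φ : Form L n) (v : Fin n → M) : φ.neg.Realize v ↔ ¬ φ.Realize v :=
  Iff.rfl

theorem realize_liftSubst {n m : ℕ} (σ : Fin n → L.Term (Fin m)) (v : Fin m → M) (x : M) :
    (fun i => (liftSubst σ i).realize (Fin.snoc (α := fun _ : Fin (m + 1) => M) v x)) =
      Fin.snoc (α := fun _ : Fin (n + 1) => M) (fun i => (σ i).realize v) x := by
  funext i
  refine Fin.lastCases ?_ (fun i => ?_) i
  · simp
  · simp [Function.comp_def]

theorem realize_subst {n : ℕ} (φ : Form L n) :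
    ∀ {m : ℕ} (σ : Fin n → L.Term (Fin m)) (v : Fin m → M),
      (φ.subst σ).Realize v ↔ φ.Realize fun i => (σ i).realize v := by
  induction φ with
  | falsum => intros; rfl
  | equal s t => simp [subst, Realize]
  | rel R ts => simp [subst, Realize]
  | and φ ψ h₁ h₂ => simp [subst, Realize, h₁, h₂]
  | or φ ψ h₁ h₂ => simp [subst, Realize, h₁, h₂]
  | imp φ ψ h₁ h₂ => simp [subst, Realize, h₁, h₂]
  | all φ h => simp [subst, Realize, h, realize_liftSubst]
  | ex φ h => simp [subst, Realize, h, realize_liftSubst]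

theorem realize_weaken {n : ℕ} (φ : Form L n) (v : Fin n → M) (x : M) :
    φ.weaken.Realize (Fin.snoc (α := fun _ : Fin (n + 1) => M) v x) ↔ φ.Realize v := by
  simp [weaken, realize_subst]

theorem realize_inst {n : ℕ} (φ : Form L (n + 1)) (t : L.Term (Fin n)) (v : Fin n → M) :
    (φ.inst t).Realize v ↔
      φ.Realize (Fin.snoc (α := fun _ : Fin (n + 1) => M) v (t.realize v)) := by
  rw [inst, realize_subst]
  refine iff_of_eq (congrArg _ ?_)
  funext i
  refine Fin.lastCases ?_ (fun i => ?_) i <;> simp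

theorem realize_ofSentence {n : ℕ} (φ : Form L 0) (v : Fin n → M) :
    (φ.ofSentence n).Realize v ↔ φ.Realize (Fin.elim0 : Fin 0 → M) := by
  rw [ofSentence, realize_subst]
  refine iff_of_eq (congrArg _ ?_)
  funext i
  exact i.elim0

theorem realize_close {n : ℕ} (φ : Form L n) :
    φ.close.Realize (Fin.elim0 : Fin 0 → M) ↔ ∀ v : Fin n → M, φ.Realize v := by
  induction n with
  | zero => exact ⟨fun h v => by rwa [Subsingleton.elim v Fin.elim0], fun h => h _⟩
  | succ n ih =>
    rw [close, ih]
    refine ⟨fun h v => ?_, fun h v x => h _⟩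
    have := h (Fin.init v) (v (Fin.last n))
    rwa [Fin.snoc_init_self (α := fun _ : Fin (n + 1) => M)] at this

variable (S : L.Substructure M)

/-- Forcing at the root of the Kripke model with two nodes whose domains are a substructure `S` of
`M` at the root and `M` at the top. -/
def Force : {n : ℕ} → Form L n → (Fin n → S) → Prop
  | _, falsum, _ => False
  | _, equal s t, v => (equal s t).Realize fun i => (v i : M)
  | _, rel R ts, v => (rel R ts).Realize fun i => (v i : M)
  | _, and φ ψ, v => φ.Force v ∧ ψ.Force v
  | _, or φ ψ, v => φ.Force v ∨ ψ.Force v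
  | _, imp φ ψ, v => (φ.Force v → ψ.Force v) ∧ (imp φ ψ).Realize fun i => (v i : M)
  | n, all φ, v => (∀ x : S, φ.Force (Fin.snoc (α := fun _ : Fin (n + 1) => S) v x)) ∧
      (all φ).Realize fun i => (v i : M)
  | n, ex φ, v => ∃ x : S, φ.Force (Fin.snoc (α := fun _ : Fin (n + 1) => S) v x)

variable {S}

theorem coe_snoc {n : ℕ} (v : Fin n → S) (x : S) :
    (fun i => ((Fin.snoc (α := fun _ : Fin (n + 1) => S) v x i : S) : M)) =
      Fin.snoc (α := fun _ : Fin (n + 1) => M) (fun i => (v i : M)) (x : M) := by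
  funext i
  refine Fin.lastCases ?_ (fun i => ?_) i <;> simp

/-- Persistence from the root to the top. For implications and universal formulas it is built into
the definition of forcing. -/
theorem Force.realize {n : ℕ} {φ : Form L n} {v : Fin n → S} (h : φ.Force S v) :
    φ.Realize fun i => (v i : M) := by
  induction φ with
  | falsum => exact h
  | equal s t => exact h
  | rel R ts => exact h
  | and φ ψ h₁ h₂ => exact ⟨h₁ h.1, h₂ h.2⟩
  | or φ ψ h₁ h₂ => exact h.imp h₁ h₂
  | imp φ ψ h₁ h₂ => exact h.2
  | all φ ih => exact h.2
  | ex φ ih =>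
    obtain ⟨x, hx⟩ := h
    have := ih hx
    rw [coe_snoc] at this
    exact ⟨x, this⟩

theorem coe_realize {α : Type} (t : L.Term α) (v : α → S) :
    ((t.realize v : S) : M) = t.realize fun i => (v i : M) :=
  (FirstOrder.Language.HomClass.realize_term S.subtype).symm

theorem force_subst {n : ℕ} (φ : Form L n) :
    ∀ {m : ℕ} (σ : Fin n → L.Term (Fin m)) (v : Fin m → S),
      (φ.subst σ).Force S v ↔ φ.Force S fun i => (σ i).realize v := by
  induction φ with
  | falsum => intros; rfl
  | equal s t => simp [subst, Force, Realize, coe_realize]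
  | rel R ts => simp [subst, Force, Realize, coe_realize]
  | and φ ψ h₁ h₂ => simp [subst, Force, h₁, h₂]
  | or φ ψ h₁ h₂ => simp [subst, Force, h₁, h₂]
  | imp φ ψ h₁ h₂ => simp [subst, Force, Realize, h₁, h₂, realize_subst, coe_realize]
  | all φ h =>
    simp [subst, Force, Realize, h, realize_liftSubst, realize_subst, coe_realize]
  | ex φ h => simp [subst, Force, h, realize_liftSubst]

theorem force_weaken {n : ℕ} (φ : Form L n) (v : Fin n → S) (x : S) :
    φ.weaken.Force S (Fin.snoc (α := fun _ : Fin (n + 1) => S) v x) ↔ φ.Force S v := by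
  simp [weaken, force_subst]

theorem force_inst {n : ℕ} (φ : Form L (n + 1)) (t : L.Term (Fin n)) (v : Fin n → S) :
    (φ.inst t).Force S v ↔
      φ.Force S (Fin.snoc (α := fun _ : Fin (n + 1) => S) v (t.realize v)) := by
  rw [inst, force_subst]
  refine iff_of_eq (congrArg _ ?_)
  funext i
  refine Fin.lastCases ?_ (fun i => ?_) i <;> simp

theorem force_ofSentence {n : ℕ} (φ : Form L 0) (v : Fin n → S) :
    (φ.ofSentence n).Force S v ↔ φ.Force S (Fin.elim0 : Fin 0 → S) := by
  rw [ofSentence, force_subst]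
  refine iff_of_eq (congrArg _ ?_)
  funext i
  exact i.elim0

/-- By persistence, falsity at the top already excludes forcing at the root. Hence negated formulas
are evaluated classically at the top, which makes hypotheses built from atoms and negations easy to
check. -/
theorem force_neg {n : ℕ} (φ : Form L n) (v : Fin n → S) :
    φ.neg.Force S v ↔ ¬ φ.Realize fun i => (v i : M) :=
  ⟨fun h => h.2, fun h => ⟨fun h' => h h'.realize, h⟩⟩

theorem force_close {n : ℕ} (φ : Form L n) :
    φ.close.Force S (Fin.elim0 : Fin 0 → S) ↔
      (∀ v : Fin n → S, φ.Force S v) ∧ ∀ v : Fin n → M, φ.Realize v := by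
  induction n with
  | zero =>
    refine ⟨fun h => ⟨fun v => ?_, fun v => ?_⟩, fun h => h.1 _⟩
    · rw [Subsingleton.elim v Fin.elim0]; exact h
    · rw [Subsingleton.elim v fun i => ((Fin.elim0 i : S) : M)]; exact h.realize
  | succ n ih =>
    rw [close, ih]
    refine ⟨fun h => ⟨fun v => ?_, fun v => ?_⟩, fun h => ⟨fun v => ⟨fun x => h.1 _, ?_⟩, ?_⟩⟩
    · have := (h.1 (Fin.init v)).1 (v (Fin.last n))
      rwa [Fin.snoc_init_self (α := fun _ : Fin (n + 1) => S)] at this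
    · have := h.2 (Fin.init v) (v (Fin.last n))
      rwa [Fin.snoc_init_self (α := fun _ : Fin (n + 1) => M)] at this
    · exact fun x => h.2 _
    · exact fun v x => h.2 _

end Form

/-! ### Soundness of derivations for truth and for forcing -/

namespace Derives

variable {L : FirstOrder.Language.{0, 0}} {M : Type} [L.Structure M] {T : Set (Form L 0)}

theorem realize [Nonempty M] (hT : ∀ φ ∈ T, φ.Realize (Fin.elim0 : Fin 0 → M)) {n : ℕ}
    {Γ : List (Form L n)} {φ : Form L n} (h : Derives T Γ φ) :
    ∀ v : Fin n → M, (∀ γ ∈ Γ, γ.Realize v) → φ.Realize v := by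
  induction h with
  | ax h => intro v _; rw [Form.realize_ofSentence]; exact hT _ h
  | hyp h => intro v hΓ; exact hΓ _ h
  | falsumE _ ih => intro v hΓ; exact (ih v hΓ).elim
  | andI _ _ ih₁ ih₂ => intro v hΓ; exact ⟨ih₁ v hΓ, ih₂ v hΓ⟩
  | andE₁ _ ih => intro v hΓ; exact (ih v hΓ).1
  | andE₂ _ ih => intro v hΓ; exact (ih v hΓ).2
  | orI₁ _ ih => intro v hΓ; exact .inl (ih v hΓ)
  | orI₂ _ ih => intro v hΓ; exact .inr (ih v hΓ)
  | orE _ _ _ ih ih₁ ih₂ =>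
    intro v hΓ
    exact (ih v hΓ).elim (fun h => ih₁ v (List.forall_mem_cons.2 ⟨h, hΓ⟩))
      fun h => ih₂ v (List.forall_mem_cons.2 ⟨h, hΓ⟩)
  | impI _ ih => intro v hΓ h; exact ih v (List.forall_mem_cons.2 ⟨h, hΓ⟩)
  | impE _ _ ih₁ ih₂ => intro v hΓ; exact ih₁ v hΓ (ih₂ v hΓ)
  | allI _ ih =>
    intro v hΓ x
    exact ih _ (List.forall_mem_map.2 fun γ hγ => (Form.realize_weaken γ v x).2 (hΓ γ hγ))
  | allE _ t ih => intro v hΓ; rw [Form.realize_inst]; exact ih v hΓ _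
  | exI t _ ih => intro v hΓ; exact ⟨_, (Form.realize_inst _ t v).1 (ih v hΓ)⟩
  | exE _ _ ih₁ ih₂ =>
    intro v hΓ
    obtain ⟨x, hx⟩ := ih₁ v hΓ
    exact (Form.realize_weaken _ v x).1 (ih₂ _ (List.forall_mem_cons.2
      ⟨hx, List.forall_mem_map.2 fun γ hγ => (Form.realize_weaken γ v x).2 (hΓ γ hγ)⟩))
  | eqRefl t => intro v _; rfl
  | eqSubst φ _ _ ih₁ ih₂ =>
    intro v hΓ
    have h := ih₂ v hΓ
    rw [Form.realize_inst, show _ = _ from ih₁ v hΓ] at h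
    exact (Form.realize_inst _ _ v).2 h
  | nonempty => intro v _; exact ⟨Classical.arbitrary M, rfl⟩

variable {S : L.Substructure M}

theorem force [Nonempty S] (hT : ∀ φ ∈ T, φ.Force S (Fin.elim0 : Fin 0 → S)) {n : ℕ}
    {Γ : List (Form L n)} {φ : Form L n} (h : Derives T Γ φ) :
    ∀ v : Fin n → S, (∀ γ ∈ Γ, γ.Force S v) → φ.Force S v := by
  have : Nonempty M := (inferInstance : Nonempty S).map Subtype.val
  -- The axioms are also true at the top, so classical soundness supplies the second component of
  -- forced implications and universal formulas.
  have hM : ∀ φ ∈ T, φ.Realize (Fin.elim0 : Fin 0 → M) := fun φ hφ => by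
    rw [Subsingleton.elim (Fin.elim0 : Fin 0 → M) fun i => ((Fin.elim0 i : S) : M)]
    exact (hT φ hφ).realize
  induction h with
  | ax h => intro v _; rw [Form.force_ofSentence]; exact hT _ h
  | hyp h => intro v hΓ; exact hΓ _ h
  | falsumE _ ih => intro v hΓ; exact (ih v hΓ).elim
  | andI _ _ ih₁ ih₂ => intro v hΓ; exact ⟨ih₁ v hΓ, ih₂ v hΓ⟩
  | andE₁ _ ih => intro v hΓ; exact (ih v hΓ).1
  | andE₂ _ ih => intro v hΓ; exact (ih v hΓ).2
  | orI₁ _ ih => intro v hΓ; exact .inl (ih v hΓ)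
  | orI₂ _ ih => intro v hΓ; exact .inr (ih v hΓ)
  | orE _ _ _ ih ih₁ ih₂ =>
    intro v hΓ
    exact (ih v hΓ).elim (fun h => ih₁ v (List.forall_mem_cons.2 ⟨h, hΓ⟩))
      fun h => ih₂ v (List.forall_mem_cons.2 ⟨h, hΓ⟩)
  | impI h ih =>
    intro v hΓ
    exact ⟨fun h => ih v (List.forall_mem_cons.2 ⟨h, hΓ⟩),
      (impI h).realize hM _ fun γ hγ => (hΓ γ hγ).realize⟩
  | impE _ _ ih₁ ih₂ => intro v hΓ; exact (ih₁ v hΓ).1 (ih₂ v hΓ)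
  | allI h ih =>
    intro v hΓ
    exact ⟨fun x => ih _ (List.forall_mem_map.2 fun γ hγ => (Form.force_weaken γ v x).2 (hΓ γ hγ)),
      (allI h).realize hM _ fun γ hγ => (hΓ γ hγ).realize⟩
  | allE _ t ih => intro v hΓ; rw [Form.force_inst]; exact (ih v hΓ).1 _
  | exI t _ ih => intro v hΓ; exact ⟨_, (Form.force_inst _ t v).1 (ih v hΓ)⟩
  | exE _ _ ih₁ ih₂ =>
    intro v hΓ
    obtain ⟨x, hx⟩ := ih₁ v hΓ
    exact (Form.force_weaken _ v x).1 (ih₂ _ (List.forall_mem_cons.2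
      ⟨hx, List.forall_mem_map.2 fun γ hγ => (Form.force_weaken γ v x).2 (hΓ γ hγ)⟩))
  | eqRefl t => intro v _; simp [Form.Force, Form.Realize]
  | @eqSubst _ _ φ s t _ _ ih₁ ih₂ =>
    intro v hΓ
    have h := ih₂ v hΓ
    have e : s.realize v = t.realize v := Subtype.ext (by
      rw [Form.coe_realize, Form.coe_realize]
      exact ih₁ v hΓ)
    rw [Form.force_inst, e] at h
    exact (Form.force_inst _ _ v).2 h
  | nonempty => intro v _; exact ⟨Classical.arbitrary S, by simp [Form.Force, Form.Realize]⟩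

end Derives

/-! ### The analytic plane over an ordered field -/

theorem snoc_apply {α : Type} {n : ℕ} (v : Fin n → α) (x : α) (i : Fin (n + 1)) :
    Fin.snoc (α := fun _ : Fin (n + 1) => α) v x i = if h : i.val < n then v ⟨i, h⟩ else x := by
  simp only [Fin.snoc, cast_eq]
  rfl

section Structures

variable {F : Type} [Field F] [LinearOrder F]

instance orderedFieldStructure : fld.Structure F where
  funMap := fun {_} f => match f with
    | .zero => fun _ => 0
    | .one => fun _ => 1
    | .neg => fun x => -x 0
    | .add => fun x => x 0 + x 1
    | .mul => fun x => x 0 * x 1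
  RelMap := fun {_} R => match R with
    | .pos => fun x => 0 < x 0

/-- Strict betweenness in the analytic plane. -/
def Between (a b c : F × F) : Prop :=
  (c.1 - b.1) * (b.2 - a.2) - (c.2 - b.2) * (b.1 - a.1) = 0 ∧
    0 < (b.1 - c.1) * (a.1 - b.1) + (b.2 - c.2) * (a.2 - b.2)

/-- The square of the distance between two points. -/
def sqDist (a b : F × F) : F :=
  (b.1 - a.1) * (b.1 - a.1) + (b.2 - a.2) * (b.2 - a.2)

instance planeStructure : geo.Structure (F × F) where
  funMap := fun {_} f => nomatch f
  RelMap := fun {_} R => match R with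
    | .bet => fun p => Between (p 0) (p 1) (p 2)
    | .cong => fun p => sqDist (p 0) (p 1) = sqDist (p 2) (p 3)

variable {n : ℕ} (w : Fin n → F)

@[simp] theorem realize_v (i : Fin n) : (v i).realize w = w i := rfl
@[simp] theorem realize_zero : (0 : fld.Term (Fin n)).realize w = 0 := rfl
@[simp] theorem realize_one : (1 : fld.Term (Fin n)).realize w = 1 := rfl
@[simp] theorem realize_neg (s : fld.Term (Fin n)) : (-s).realize w = -s.realize w := rfl
@[simp] theorem realize_add (s t : fld.Term (Fin n)) :
    (s + t).realize w = s.realize w + t.realize w := rfl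
@[simp] theorem realize_mul (s t : fld.Term (Fin n)) :
    (s * t).realize w = s.realize w * t.realize w := rfl
@[simp] theorem realize_sub (s t : fld.Term (Fin n)) :
    (s - t).realize w = s.realize w - t.realize w :=
  (sub_eq_add_neg _ _).symm
@[simp] theorem realize_pos (s : fld.Term (Fin n)) : (pos s).Realize w ↔ 0 < s.realize w := Iff.rfl

/-- The plane over a substructure. -/
def plane (S : fld.Substructure F) : geo.Substructure (F × F) where
  carrier := {p | p.1 ∈ S ∧ p.2 ∈ S}
  fun_mem := fun f => nomatch f

variable (S : fld.Substructure F)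

theorem force_pos {S : fld.Substructure F} (s : fld.Term (Fin n)) (u : Fin n → S) :
    (pos s).Force S u ↔ 0 < s.realize fun i => (u i : F) := Iff.rfl

/-- The coordinates of a list of points. -/
def coords {α : Type} (v : Fin n → α × α) : Fin (2 * n) → α := fun j =>
  if j.val % 2 = 0 then (v ⟨j / 2, by omega⟩).1 else (v ⟨j / 2, by omega⟩).2

/-- The point variable bound by a quantifier is translated into the ring variables `2 * n` and `2 *
n + 1`. The types agree because `2 * (n + 1)` unfolds to `2 * n + 1 + 1`. -/
theorem coords_snoc {α : Type} (v : Fin n → α × α) (p : α × α) :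
    coords (Fin.snoc (α := fun _ : Fin (n + 1) => α × α) v p) =
      Fin.snoc (α := fun _ : Fin (2 * n + 1 + 1) => α)
        (Fin.snoc (α := fun _ : Fin (2 * n + 1) => α) (coords v) p.1) p.2 := by
  funext ⟨j, hj⟩
  simp only [coords, snoc_apply]
  rcases lt_trichotomy j (2 * n) with h | h | h
  · rw [dif_pos (by omega), dif_pos (by omega), dif_pos (by omega)]
  · subst h
    simp
  · obtain rfl : j = 2 * n + 1 := by omega
    have h₁ : (2 * n + 1) / 2 = n := by omega
    have h₂ : (2 * n + 1) % 2 = 1 := by omega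
    simp [h₁, h₂]

theorem coords_even {α : Type} (v : Fin n → α × α) (i : Fin n) :
    coords v ⟨2 * i, by omega⟩ = (v i).1 := by
  simp [coords]

theorem coords_odd {α : Type} (v : Fin n → α × α) (i : Fin n) :
    coords v ⟨2 * i + 1, by omega⟩ = (v i).2 := by
  have h₁ : (2 * i.val + 1) / 2 = i := by omega
  have h₂ : (2 * i.val + 1) % 2 = 1 := by omega
  simp [coords, h₁, h₂]

@[simp] theorem realize_cx (u : Fin n → F × F) (i : Fin n) :
    (cx i).realize (coords u) = (u i).1 := coords_even u i

@[simp] theorem realize_cy (u : Fin n → F × F) (i : Fin n) :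
    (cy i).realize (coords u) = (u i).2 := coords_odd u i

theorem realize_geoVar {M : Type} [geo.Structure M] (t : geo.Term (Fin n)) (u : Fin n → M) :
    t.realize u = u (geoVar t) := by
  cases t with
  | var i => rfl
  | func f ts => exact nomatch f

theorem realize_bar (φ : Form geo n) (u : Fin n → F × F) :
    (bar φ).Realize (coords u) ↔ φ.Realize u := by
  induction φ with
  | falsum => rfl
  | equal s t => simp [bar, Form.Realize, realize_geoVar, Prod.ext_iff]
  | rel R ts =>
    cases R with
    | bet => simp [bar, Form.Realize, realize_geoVar, barRel,
        FirstOrder.Language.Structure.RelMap, Between]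
    | cong => simp [bar, Form.Realize, realize_geoVar, barRel,
        FirstOrder.Language.Structure.RelMap, sqDist]
  | and φ ψ h₁ h₂ => simp [bar, Form.Realize, h₁, h₂]
  | or φ ψ h₁ h₂ => simp [bar, Form.Realize, h₁, h₂]
  | imp φ ψ h₁ h₂ => simp [bar, Form.Realize, h₁, h₂]
  | all φ ih =>
    refine ⟨fun h p => ?_, fun h x y => ?_⟩
    · rw [← ih, coords_snoc]; exact h p.1 p.2
    · have := (ih _).2 (h (x, y))
      rwa [coords_snoc] at this
  | ex φ ih =>
    refine ⟨?_, ?_⟩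
    · rintro ⟨x, y, h⟩
      refine ⟨(x, y), ?_⟩
      rw [← ih, coords_snoc]; exact h
    · rintro ⟨p, h⟩
      rw [← ih, coords_snoc] at h
      exact ⟨p.1, p.2, h⟩

variable {S}

/-- The pair of coordinates of a point of the plane over a substructure. -/
def toPair (p : plane S) : S × S := (⟨p.1.1, p.2.1⟩, ⟨p.1.2, p.2.2⟩)

theorem coe_coords (u : Fin n → plane S) :
    (fun j => (coords (α := S) (fun i => toPair (u i)) j : F)) = coords fun i => (u i : F × F) := by
  funext j
  simp only [coords]
  split <;> rfl

theorem toPair_snoc (u : Fin n → plane S) (p : plane S) :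
    (fun i => toPair (Fin.snoc (α := fun _ : Fin (n + 1) => plane S) u p i)) =
      Fin.snoc (α := fun _ : Fin (n + 1) => S × S) (fun i => toPair (u i)) (toPair p) := by
  funext i
  refine Fin.lastCases ?_ (fun i => ?_) i <;> simp

/-- The root component goes by induction, since a point of the small plane is a pair of elements of
`S`; the top component is `realize_bar`. -/
theorem force_bar (φ : Form geo n) (u : Fin n → plane S) :
    (bar φ).Force S (coords fun i => toPair (u i)) ↔ φ.Force (plane S) u := by
  induction φ with
  | falsum => rfl
  | equal s t =>
    have := realize_bar (.equal s t) fun i => (u i : F × F)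
    rw [← coe_coords] at this
    exact this
  | rel R ts =>
    have := realize_bar (.rel R ts) fun i => (u i : F × F)
    rw [← coe_coords] at this
    cases R <;> exact this
  | and φ ψ h₁ h₂ => simp [bar, Form.Force, h₁, h₂]
  | or φ ψ h₁ h₂ => simp [bar, Form.Force, h₁, h₂]
  | imp φ ψ h₁ h₂ =>
    have := realize_bar (.imp φ ψ) fun i => (u i : F × F)
    rw [← coe_coords] at this
    exact and_congr (imp_congr (h₁ u) (h₂ u)) this
  | all φ ih =>
    have := realize_bar (.all φ) fun i => (u i : F × F)
    rw [← coe_coords] at this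
    refine ⟨fun h => ⟨fun p => ?_, this.1 ?_⟩, fun h => ⟨fun x => ⟨fun y => ?_, ?_⟩, ?_⟩⟩
    · rw [← ih, toPair_snoc, coords_snoc]
      exact (h.1 _).1 _
    · exact h.realize
    · have := (ih _).2 (h.1 ⟨(x, y), x.2, y.2⟩)
      rw [toPair_snoc, coords_snoc] at this
      exact this
    · rw [Form.coe_snoc]
      exact this.2 h.2 x
    · exact this.2 h.2
  | ex φ ih =>
    refine ⟨?_, ?_⟩
    · rintro ⟨x, y, h⟩
      refine ⟨⟨(x, y), x.2, y.2⟩, ?_⟩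
      rw [← ih, toPair_snoc, coords_snoc]; exact h
    · rintro ⟨p, h⟩
      rw [← ih, toPair_snoc, coords_snoc] at h
      exact ⟨_, _, h⟩

end Structures

/-! ### Finite elements of an ordered field form a Kripke model of Playfair rings -/

section Kripke

variable (F : Type) [Field F] [LinearOrder F] [IsStrictOrderedRing F]

/-- The finite elements of an ordered field. -/
def finiteElements : fld.Substructure F where
  carrier := {x | ∃ n : ℕ, |x| ≤ n}
  fun_mem := fun {_} f x hx => by
    cases f with
    | zero => exact ⟨0, by simp [FirstOrder.Language.Structure.funMap]⟩
    | one => exact ⟨1, by simp [FirstOrder.Language.Structure.funMap]⟩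
    | neg =>
      obtain ⟨n, hn⟩ := hx 0
      exact ⟨n, by simpa [FirstOrder.Language.Structure.funMap] using hn⟩
    | add =>
      obtain ⟨n, hn⟩ := hx 0
      obtain ⟨m, hm⟩ := hx 1
      refine ⟨n + m, ?_⟩
      push_cast
      exact (abs_add_le _ _).trans (add_le_add hn hm)
    | mul =>
      obtain ⟨n, hn⟩ := hx 0
      obtain ⟨m, hm⟩ := hx 1
      refine ⟨n * m, ?_⟩
      push_cast
      exact (abs_mul _ _).le.trans (mul_le_mul hn hm (abs_nonneg _) (Nat.cast_nonneg n))

variable {F}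

theorem mem_finiteElements_of_abs_le {x y : F} (hy : y ∈ finiteElements F) (h : |x| ≤ |y|) :
    x ∈ finiteElements F := by
  obtain ⟨n, hn⟩ := hy
  exact ⟨n, h.trans hn⟩

theorem abs_le_mul_of_isAbs {a b y c d : F} (hc : 0 ≤ c) (hca : c * c = a * a) (hd : 0 ≤ d)
    (hdb : d * d = b * b) (h : c ≤ d * y) : |a| ≤ |b| * y := by
  rw [mul_self_eq_mul_self_iff] at hca hdb
  have h₁ : c = |a| := by
    rcases hca with h | h
    · rw [← h, abs_of_nonneg hc]
    · rw [← abs_neg, ← h, abs_of_nonneg hc]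
  have h₂ : d = |b| := by
    rcases hdb with h | h
    · rw [← h, abs_of_nonneg hd]
    · rw [← abs_neg, ← h, abs_of_nonneg hd]
  rwa [← h₁, ← h₂]

/-- The bound on `z` is what makes the quotient finite as soon as `y` is. For `b = 0` also `a = 0`,
and `z = 0` serves. -/
theorem exists_eq_mul_of_abs_le {a b y : F} (h : |a| ≤ |b| * y) : ∃ z, |z| ≤ |y| ∧ a = b * z := by
  by_cases hb : b = 0
  · subst hb
    exact ⟨0, by simp, by simpa using h⟩
  · refine ⟨a / b, ?_, by field_simp⟩
    rw [abs_div, div_le_iff₀ (abs_pos.2 hb), mul_comm]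
    exact h.trans (mul_le_mul_of_nonneg_left (le_abs_self y) (abs_nonneg b))

/-- Apart from the existential axioms, everything is inherited from `F`, because atoms and negations
mean the same at both nodes. In the existential axioms the witness found in `F` has to be shown
finite. -/
theorem force_playfairRings (hF : ∀ x : F, 0 ≤ x → ∃ z, 0 ≤ z ∧ z * z = x)
    {φ : Form fld 0} (hφ : φ ∈ playfairRings) :
    φ.Force (finiteElements F) (Fin.elim0 : Fin 0 → finiteElements F) := by
  cases hφ with
  | add_assoc =>
    rw [Form.force_close]
    simp [Form.Force, Form.Realize, add_assoc]
  | add_comm =>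
    rw [Form.force_close]
    simp [Form.Force, Form.Realize, add_comm]
  | add_zero =>
    rw [Form.force_close]
    simp [Form.Force, Form.Realize]
  | add_neg =>
    rw [Form.force_close]
    simp [Form.Force, Form.Realize]
  | mul_assoc =>
    rw [Form.force_close]
    simp [Form.Force, Form.Realize, mul_assoc]
  | mul_comm =>
    rw [Form.force_close]
    simp [Form.Force, Form.Realize, mul_comm]
  | mul_one =>
    rw [Form.force_close]
    simp [Form.Force, Form.Realize]
  | mul_add =>
    rw [Form.force_close]
    simp [Form.Force, Form.Realize, mul_add]
  | eq_stable =>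
    rw [Form.force_close]
    simp [Form.Force, Form.Realize, Form.neg]
  | zero_ne_one =>
    simp [Form.Force, Form.Realize, Form.neg]
  | pos_add_mul =>
    rw [Form.force_close]
    simp +contextual [Form.Force, Form.Realize, force_pos, add_pos]
  | pos_asymm =>
    rw [Form.force_close]
    simp only [Form.Force, Form.Realize, Form.force_neg, Form.realize_neg, realize_pos, realize_add,
      realize_v, realize_zero]
    have key : ∀ x y : F, x + y = 0 → ¬ (0 < x ∧ 0 < y) := fun x y h h' => by linarith [h'.1, h'.2]
    exact ⟨fun u => ⟨key _ _, key _ _⟩, fun u => key _ _⟩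
  | eq_zero =>
    rw [Form.force_close]
    simp only [Form.Force, Form.Realize, Form.force_neg, Form.realize_neg, realize_pos, realize_add,
      realize_v, realize_zero]
    have key : ∀ x y : F, (x + y = 0 ∧ ¬ 0 < x ∧ ¬ 0 < y) → x = 0 := fun x y h => by
      linarith [not_lt.1 h.2.1, not_lt.1 h.2.2, h.1]
    exact ⟨fun u => ⟨key _ _, key _ _⟩, fun u => key _ _⟩
  | sqrt =>
    rw [Form.force_close]
    simp only [Form.Force, Form.Realize, Form.force_neg, Form.realize_neg, le, realize_pos,
      realize_add, realize_v, realize_zero, realize_sub, realize_mul, snoc_apply, zero_sub,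
      Left.neg_pos_iff, not_lt]
    have key : ∀ x y : F, (x + y = 0 ∧ y ≤ 0) → ∃ z, 0 ≤ z ∧ z * z = x := fun x y h =>
      hF x (by linarith [h.1, h.2])
    refine ⟨fun u => ⟨fun h => ?_, key _ _⟩, fun u => key _ _⟩
    obtain ⟨z, hz, hzx⟩ := key _ _ h
    obtain ⟨n, hn⟩ := (u 0).2
    -- With `z² ≤ n`, the bound `n + 1` for `z` avoids a square root and covers `n = 0`.
    refine ⟨⟨z, n + 1, ?_⟩, hz, hzx⟩
    push_cast
    rw [abs_of_nonneg hz]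
    rw [← hzx, abs_of_nonneg (mul_nonneg hz hz)] at hn
    nlinarith
  | markov =>
    rw [Form.force_close]
    simp [Form.Force, Form.Realize, Form.force_neg, Form.realize_neg, force_pos]
  | no_inverse =>
    rw [Form.force_close]
    simp only [Form.Force, Form.Realize, Form.force_neg, Form.realize_neg, realize_v, realize_zero,
      realize_mul, realize_one, snoc_apply]
    have key : ∀ x : F, (∀ y, ¬ x * y = 1) → x = 0 := fun x h =>
      by_contra fun hx => h x⁻¹ (mul_inv_cancel₀ hx)
    -- A forced "no inverse" speaks about `F` as well, where nonzero elements do have inverses,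
    -- possibly infinite ones. A nonzero infinitesimal therefore does not violate this axiom.
    exact ⟨fun u => ⟨fun h => key _ h.2, key _⟩, fun u => key _⟩
  | bounded_quotient =>
    rw [Form.force_close]
    simp only [Form.Force, Form.Realize, Form.force_neg, Form.realize_neg, le, isAbs, realize_pos,
      realize_v, realize_zero, realize_sub, realize_mul, snoc_apply, zero_sub,
      Left.neg_pos_iff, not_lt, sub_pos]
    have key : ∀ a b y c d : F,
        ((0 ≤ c ∧ c * c = a * a) ∧ (0 ≤ d ∧ d * d = b * b) ∧ c ≤ d * y) →
          ∃ z, |z| ≤ |y| ∧ a = b * z := fun a b y c d h =>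
      exists_eq_mul_of_abs_le (abs_le_mul_of_isAbs h.1.1 h.1.2 h.2.1.1 h.2.1.2 h.2.2)
    refine ⟨fun u => ⟨fun h => ?_, fun h => ?_⟩, fun u h => ?_⟩
    · obtain ⟨z, hz, e⟩ := key _ _ _ _ _ h
      exact ⟨⟨z, mem_finiteElements_of_abs_le (u 2).2 hz⟩, e⟩
    · obtain ⟨z, hz, e⟩ := key _ _ _ _ _ h
      exact ⟨z, e⟩
    · obtain ⟨z, hz, e⟩ := key _ _ _ _ _ h
      exact ⟨z, e⟩

end Kripke

/-! ### Truth and forcing of geometric formulas -/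

section GeometricSemantics

variable {M : Type} [geo.Structure M]

/-- Strict betweenness in a structure for the language of geometry. -/
def Bet (a b c : M) : Prop :=
  FirstOrder.Language.Structure.RelMap (L := geo) GeoRel.bet ![a, b, c]

/-- Equidistance in a structure for the language of geometry. -/
def Cong (a b c d : M) : Prop :=
  FirstOrder.Language.Structure.RelMap (L := geo) GeoRel.cong ![a, b, c, d]

/-- Non-strict betweenness. -/
def BetT (a b c : M) : Prop := a = b ∨ b = c ∨ Bet a b c

/-- The point `x` is on the line through `a` and `b`. -/
def OnLine (x a b : M) : Prop := Bet a b x ∨ Bet b x a ∨ Bet x a b ∨ x = a ∨ x = b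

/-- Comparison of segments. -/
def SegLe (a b c d : M) : Prop := ∃ e, BetT c e d ∧ Cong a b c e

variable {n : ℕ} (u : Fin n → M) (a b c d : Fin n)

theorem realize_eqPt : (eqPt a b).Realize u ↔ u a = u b := Iff.rfl

theorem realize_ne : (ne a b).Realize u ↔ u a ≠ u b := Iff.rfl

theorem realize_bet : (bet a b c).Realize u ↔ Bet (u a) (u b) (u c) := by
  refine iff_of_eq (congrArg (FirstOrder.Language.Structure.RelMap (L := geo) GeoRel.bet) ?_)
  funext i
  fin_cases i <;> rfl

theorem realize_cong : (cong a b c d).Realize u ↔ Cong (u a) (u b) (u c) (u d) := by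
  refine iff_of_eq (congrArg (FirstOrder.Language.Structure.RelMap (L := geo) GeoRel.cong) ?_)
  funext i
  fin_cases i <;> rfl

theorem realize_betT : (betT a b c).Realize u ↔ BetT (u a) (u b) (u c) := by
  rw [betT, Form.realize_neg]
  simp only [Form.Realize, Form.realize_neg, realize_ne, realize_bet, BetT]
  tauto

theorem realize_on : (on a b c).Realize u ↔ OnLine (u a) (u b) (u c) := by
  rw [on, Form.realize_neg]
  simp only [Form.Realize, Form.realize_neg, realize_eqPt, realize_bet, OnLine, not_not]

theorem realize_nonCol : (nonCol a b c).Realize u ↔ u a ≠ u b ∧ ¬ OnLine (u c) (u a) (u b) := by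
  simp only [nonCol, Form.Realize, Form.realize_neg, realize_ne, realize_on]

theorem realize_segLe : (segLe a b c d).Realize u ↔ SegLe (u a) (u b) (u c) (u d) := by
  simp only [segLe, Form.Realize, realize_betT, realize_cong, SegLe, Fin.snoc_castSucc,
    Fin.snoc_last]

theorem realize_parallel : (parallel a b c d).Realize u ↔
    ∀ x, ¬ (OnLine x (u a) (u b) ∧ OnLine x (u c) (u d)) := by
  simp only [parallel, Form.Realize, Form.realize_neg, realize_on, Fin.snoc_castSucc,
    Fin.snoc_last]

theorem realize_meet : (meet a b c d).Realize u ↔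
    ∃ x, OnLine x (u a) (u b) ∧ OnLine x (u c) (u d) := by
  simp only [meet, Form.Realize, realize_on, Fin.snoc_castSucc, Fin.snoc_last]

variable {S : geo.Substructure M} (w : Fin n → S)

theorem force_ne : (ne a b).Force S w ↔ (w a : M) ≠ w b := by
  rw [ne, Form.force_neg, realize_eqPt]

theorem force_bet : (bet a b c).Force S w ↔ Bet (w a : M) (w b) (w c) :=
  realize_bet (fun i => (w i : M)) a b c

theorem force_cong : (cong a b c d).Force S w ↔ Cong (w a : M) (w b) (w c) (w d) :=
  realize_cong (fun i => (w i : M)) a b c d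

theorem force_on : (on a b c).Force S w ↔ OnLine (w a : M) (w b) (w c) := by
  rw [on, Form.force_neg, ← Form.realize_neg]
  exact realize_on (fun i => (w i : M)) a b c

/-- Playfair's axiom in a structure for the language of geometry. -/
def Playfair (M : Type) [geo.Structure M] : Prop :=
  ∀ k₁ k₂ l₁ l₂ m₁ m₂ p q : M, k₁ ≠ k₂ → l₁ ≠ l₂ → m₁ ≠ m₂ →
    (∀ x, ¬ (OnLine x k₁ k₂ ∧ OnLine x l₁ l₂)) → (∀ x, ¬ (OnLine x m₁ m₂ ∧ OnLine x l₁ l₂)) →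
    OnLine p k₁ k₂ → OnLine p m₁ m₂ → OnLine q k₁ k₂ → OnLine q m₁ m₂

theorem Playfair.realize (h : Playfair M) (u : Fin n → M) (k₁ k₂ l₁ l₂ m₁ m₂ p q : Fin n) :
    (playfairAt k₁ k₂ l₁ l₂ m₁ m₂ p q).Realize u := by
  simp only [playfairAt, Form.iff, Form.Realize, realize_ne, realize_parallel, realize_on]
  rintro ⟨hk, hl, hm, hkl, hml, hpk, hpm⟩
  exact ⟨h _ _ _ _ _ _ _ _ hk hl hm hkl hml hpk hpm, h _ _ _ _ _ _ _ _ hm hl hk hml hkl hpm hpk⟩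

/-- Forced hypotheses are true at the top, where the axiom applies, and its conclusion returns to
the root because incidence is a double negation. Lines parallel at the root are thus parallel in all
of `M`, which excludes lines meeting only at an infinitely distant point. -/
theorem Playfair.force (h : Playfair M) : playfair.Force S (Fin.elim0 : Fin 0 → S) := by
  rw [playfair, Form.force_close]
  refine ⟨fun w => ⟨fun hw => ?_, h.realize _ _ _ _ _ _ _ _ _⟩, fun u => h.realize _ _ _ _ _ _ _ _ _⟩
  have := h.realize (fun i => (w i : M)) 0 1 2 3 4 5 6 7 hw.realize
  have on_iff : ∀ a b c : Fin 8,
      (on a b c).Force S w ↔ (on a b c).Realize fun i => (w i : M) := fun a b c => by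
    rw [force_on, realize_on]
  exact ⟨⟨fun h => (on_iff _ _ _).2 (this.1 ((on_iff _ _ _).1 h)), this.1⟩,
    ⟨fun h => (on_iff _ _ _).2 (this.2 ((on_iff _ _ _).1 h)), this.2⟩⟩

end GeometricSemantics

/-! ### Lines of the analytic plane -/

section AnalyticPlane

variable {F : Type} [Field F] [LinearOrder F]

theorem bet_iff (a b c : F × F) : Bet a b c ↔ Between a b c := Iff.rfl

theorem cong_iff (a b c d : F × F) : Cong a b c d ↔ sqDist a b = sqDist c d := Iff.rfl

variable [IsStrictOrderedRing F]

theorem exists_eq_add_mul_of_cross_eq_zero {a b x : F × F} (hab : a ≠ b)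
    (h : (b.1 - a.1) * (x.2 - a.2) - (b.2 - a.2) * (x.1 - a.1) = 0) :
    ∃ t, x = (a.1 + t * (b.1 - a.1), a.2 + t * (b.2 - a.2)) := by
  by_cases h₁ : b.1 - a.1 = 0
  · have h₂ : b.2 - a.2 ≠ 0 := fun h₂ => hab (Prod.ext (by linarith) (by linarith))
    refine ⟨(x.2 - a.2) / (b.2 - a.2), Prod.ext ?_ ?_⟩
    · rw [h₁, zero_mul, zero_sub, neg_eq_zero] at h
      have := (mul_eq_zero.1 h).resolve_left h₂
      simp only [h₁]
      linarith
    · simp only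
      field_simp
      ring
  · refine ⟨(x.1 - a.1) / (b.1 - a.1), Prod.ext ?_ ?_⟩
    · simp only
      field_simp
      ring
    · simp only
      field_simp
      linear_combination h

theorem onLine_iff {x a b : F × F} (hab : a ≠ b) :
    OnLine x a b ↔ (b.1 - a.1) * (x.2 - a.2) - (b.2 - a.2) * (x.1 - a.1) = 0 := by
  simp only [OnLine, bet_iff, Between]
  constructor
  · rintro (⟨h, -⟩ | ⟨h, -⟩ | ⟨h, -⟩ | rfl | rfl)
    · linear_combination -h
    · linear_combination -h
    · linear_combination -h
    · ring
    · ring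
  · intro h
    obtain ⟨t, rfl⟩ := exists_eq_add_mul_of_cross_eq_zero hab h
    have hpos : 0 < (b.1 - a.1) * (b.1 - a.1) + (b.2 - a.2) * (b.2 - a.2) := by
      refine (add_nonneg (mul_self_nonneg _) (mul_self_nonneg _)).lt_of_ne' fun h => hab ?_
      obtain ⟨h₁, h₂⟩ := (mul_self_add_mul_self_eq_zero).1 h
      exact Prod.ext (by linarith) (by linarith)
    -- The position of the parameter `t` relative to `0` and `1` selects the disjunct of `OnLine`.
    rcases lt_trichotomy t 0 with ht | rfl | ht
    · refine .inr (.inr (.inl ⟨by ring, ?_⟩))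
      have := mul_pos (neg_pos.2 ht) hpos
      linarith
    · simp
    · rcases lt_trichotomy t 1 with ht' | rfl | ht'
      · refine .inr (.inl ⟨by ring, ?_⟩)
        have := mul_pos (mul_pos ht (sub_pos.2 ht')) hpos
        linarith
      · simp
      · refine .inl ⟨by ring, ?_⟩
        have := mul_pos (sub_pos.2 ht') hpos
        linarith

/-- Cramer's rule: if the determinant `D` of the directions were nonzero, dividing by it would give
the common point. For finite points the quotient may be infinite. -/
theorem cross_eq_zero_of_parallel {k₁ k₂ l₁ l₂ : F × F} (hk : k₁ ≠ k₂) (hl : l₁ ≠ l₂)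
    (h : ∀ x, ¬ (OnLine x k₁ k₂ ∧ OnLine x l₁ l₂)) :
    (k₂.1 - k₁.1) * (l₂.2 - l₁.2) - (k₂.2 - k₁.2) * (l₂.1 - l₁.1) = 0 := by
  by_contra hne
  set D := (k₂.1 - k₁.1) * (l₂.2 - l₁.2) - (k₂.2 - k₁.2) * (l₂.1 - l₁.1) with hD
  set s := ((l₁.1 - k₁.1) * (l₂.2 - l₁.2) - (l₁.2 - k₁.2) * (l₂.1 - l₁.1)) / D with hs
  have hsD : s * D = (l₁.1 - k₁.1) * (l₂.2 - l₁.2) - (l₁.2 - k₁.2) * (l₂.1 - l₁.1) := by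
    rw [hs]; field_simp
  refine h (k₁.1 + s * (k₂.1 - k₁.1), k₁.2 + s * (k₂.2 - k₁.2)) ⟨?_, ?_⟩
  · rw [onLine_iff hk]; ring
  · rw [onLine_iff hl]
    rw [hD] at hsD
    linear_combination -hsD

theorem cross_eq_zero_trans {u₁ u₂ w₁ w₂ z₁ z₂ : F} (hw : w₁ ≠ 0 ∨ w₂ ≠ 0)
    (h : u₁ * w₂ - u₂ * w₁ = 0) (h' : w₁ * z₂ - w₂ * z₁ = 0) : u₁ * z₂ - u₂ * z₁ = 0 := by
  rcases hw with hw | hw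
  · refine (mul_eq_zero.1 (?_ : w₁ * _ = 0)).resolve_left hw
    linear_combination u₁ * h' + z₁ * h
  · refine (mul_eq_zero.1 (?_ : w₂ * _ = 0)).resolve_left hw
    linear_combination u₂ * h' + z₂ * h

theorem sub_ne_zero_or {a b : F × F} (h : a ≠ b) : b.1 - a.1 ≠ 0 ∨ b.2 - a.2 ≠ 0 := by
  by_contra! h'
  exact h (Prod.ext (by linarith [h'.1]) (by linarith [h'.2]))

/-- Both lines have the direction of `L`, and proportionality to a nonzero vector is transitive, so
`q - p` is proportional to the direction of the second line as well. -/
theorem playfair_plane : Playfair (F × F) := by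
  intro k₁ k₂ l₁ l₂ m₁ m₂ p q hk hl hm hkl hml hpk hpm hqk
  have h₁ := cross_eq_zero_of_parallel hk hl hkl
  have h₂ := cross_eq_zero_of_parallel hm hl hml
  rw [onLine_iff hk] at hpk hqk
  rw [onLine_iff hm] at hpm ⊢
  have h₃ := cross_eq_zero_trans (sub_ne_zero_or hl) h₁
    (show _ * (m₂.2 - m₁.2) - _ * (m₂.1 - m₁.1) = 0 by linear_combination -h₂)
  have h₄ := cross_eq_zero_trans (u₁ := q.1 - p.1) (u₂ := q.2 - p.2) (sub_ne_zero_or hk)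
    (by linear_combination hpk - hqk) h₃
  linear_combination hpm - h₄

end AnalyticPlane

/-! ### Counterexamples with an infinitesimal -/

section Infinitesimal

variable {F : Type} [Field F] [LinearOrder F] [IsStrictOrderedRing F]

/-- A point of the finite plane, given by finite coordinates. -/
def finitePoint (x y : F) (hx : |x| ≤ 2) (hy : |y| ≤ 2) : plane (finiteElements F) :=
  ⟨(x, y), ⟨2, by exact_mod_cast hx⟩, ⟨2, by exact_mod_cast hy⟩⟩

theorem finitePoint_coe (x y : F) (hx : |x| ≤ 2) (hy : |y| ≤ 2) :
    (finitePoint x y hx hy : F × F) = (x, y) := rfl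

theorem mul_lt_one_of_finite {ε x : F} (h₀ : 0 < ε) (hε : ∀ n : ℕ, n * ε < 1)
    (hx : x ∈ finiteElements F) : x * ε < 1 := by
  obtain ⟨n, hn⟩ := hx
  exact (mul_le_mul_of_nonneg_right ((le_abs_self x).trans hn) h₀.le).trans_lt (hε n)

variable {ε : F}

theorem not_force_strongParallel (h₀ : 0 < ε) (hε : ∀ n : ℕ, n * ε < 1) :
    ¬ strongParallel.Force (plane (finiteElements F)) (Fin.elim0 : Fin 0 → _) := by
  intro h
  have h₁ : ε < 1 := by simpa using hε 1
  rw [strongParallel, Form.force_close] at h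
  -- `L` is the `x`-axis, `pr` is the line `y = 1`, and `pa` is the line `y = 1 - ε x`, so the
  -- common point would have abscissa `1 / ε`.
  have h := (h.1 ![finitePoint 0 1 (by simp) (by norm_num), finitePoint 0 0 (by simp) (by simp),
    finitePoint 1 1 (by norm_num) (by norm_num), finitePoint (-1) 0 (by norm_num) (by simp),
    finitePoint 0 2⁻¹ (by simp) (by rw [abs_of_pos] <;> norm_num),
    finitePoint 1 (1 - ε) (by norm_num) (by rw [abs_of_pos] <;> linarith)]).1
  simp only [Form.Force, meet, force_bet, force_cong, force_ne, Form.force_neg, realize_on,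
    force_on, Fin.snoc_castSucc, Fin.snoc_last, Matrix.cons_val, finitePoint_coe] at h
  have h2 : (2 : F)⁻¹ * 2 = 1 := by norm_num
  obtain ⟨e, he₁, he₂⟩ := h ⟨by rw [bet_iff, Between]; constructor <;> norm_num, by rw [bet_iff, Between]; constructor <;> norm_num, by simp,
    by rw [onLine_iff (by simp)]; simp, by simp, by simp,
    by rw [onLine_iff (by simp)]; simp [h₀.ne'], by simp [cong_iff, sqDist]; norm_num,
    by simp [cong_iff, sqDist]; norm_num⟩
  rw [onLine_iff (by simp)] at he₁ he₂
  simp at he₁ he₂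
  have := mul_lt_one_of_finite h₀ hε e.2.1
  rw [he₁] at he₂
  linarith

theorem not_force_euclid5 (h₀ : 0 < ε) (hε : ∀ n : ℕ, n * ε < 1) :
    ¬ euclid5.Force (plane (finiteElements F)) (Fin.elim0 : Fin 0 → _) := by
  intro h
  have h₁ : ε < 1 := by simpa using hε 1
  have h₁' : 1 - ε ≠ 0 := by linarith
  rw [euclid5, Form.force_close] at h
  -- Here `a` must lie between `q` and `r`, so it is moved to `(1 - ε, 1 - ε)` on the diagonal.
  have h := (h.1 ![finitePoint 0 1 (by simp) (by norm_num), finitePoint 0 0 (by simp) (by simp),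
    finitePoint 1 1 (by norm_num) (by norm_num), finitePoint (-1) 0 (by norm_num) (by simp),
    finitePoint 0 2⁻¹ (by simp) (by rw [abs_of_pos] <;> norm_num),
    finitePoint (1 - ε) (1 - ε) (by rw [abs_of_pos] <;> linarith)
      (by rw [abs_of_pos] <;> linarith)]).1
  simp only [Form.Force, force_bet, force_cong, force_ne, Form.force_neg, realize_on,
    force_on, Fin.snoc_castSucc, Fin.snoc_last, Matrix.cons_val, finitePoint_coe] at h
  have h2 : (2 : F)⁻¹ * 2 = 1 := by norm_num
  obtain ⟨e, he₁, he₂, -, -⟩ := h ⟨by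
      rw [bet_iff, Between]
      exact ⟨by ring, by nlinarith [mul_pos h₀ (sub_pos.2 h₁)]⟩,
    by rw [bet_iff, Between]; constructor <;> norm_num, by rw [bet_iff, Between]; constructor <;> norm_num,
    by simp [cong_iff, sqDist]; norm_num, by simp [cong_iff, sqDist]; norm_num,
    by simp, by simp, by simp [h₁'.symm],
    by rw [onLine_iff (by simp)]; simp⟩
  rw [onLine_iff (by simp)] at he₁
  rw [onLine_iff (by simp [h₁'.symm])] at he₂
  simp at he₁ he₂
  -- The line `pa` now meets the axis at `1 / ε - 1`; the shift by one gives exactly `1 / ε`.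
  have h3 : (e : F × F).1 + 1 ∈ finiteElements F := by
    obtain ⟨n, hn⟩ := e.2.1
    refine ⟨n + 1, (abs_add_le _ _).trans ?_⟩
    push_cast
    simpa using hn
  have := mul_lt_one_of_finite h₀ hε h3
  rw [he₁] at he₂
  linarith

/-- The first congruence puts the center on `x = 3 / 2`. The second then says that its ordinate `y`
satisfies `ε y = 1 + ε² / 2`, so `y` exceeds every natural number. All circumscription
counterexamples use this triangle. -/
theorem not_cong_of_finite (h₀ : 0 < ε) (hε : ∀ n : ℕ, n * ε < 1)
    (e : plane (finiteElements F)) :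
    ¬ (Cong (e : F × F) (1, 0) e (2, 0) ∧ Cong (e : F × F) (1, 0) e (0, ε)) := by
  rintro ⟨h₁, h₂⟩
  simp only [cong_iff, sqDist] at h₁ h₂
  have := mul_lt_one_of_finite h₀ hε e.2.2
  have h₃ : (e : F × F).1 = 3 / 2 := by linarith
  rw [h₃] at h₂
  nlinarith [mul_self_nonneg ε]

theorem not_force_triangleCircumscription (h₀ : 0 < ε) (hε : ∀ n : ℕ, n * ε < 1) :
    ¬ triangleCircumscription.Force (plane (finiteElements F)) (Fin.elim0 : Fin 0 → _) := by
  intro h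
  have h₁ : ε < 1 := by simpa using hε 1
  rw [triangleCircumscription, Form.force_close] at h
  have h := (h.1 ![finitePoint 1 0 (by norm_num) (by simp), finitePoint 2 0 (by simp) (by simp),
    finitePoint 0 ε (by simp) (by rw [abs_of_pos] <;> linarith)]).1
  simp only [Form.Force, hasCenter, nonCol, force_cong, force_ne, Form.force_neg,
    realize_on, Fin.snoc_castSucc, Fin.snoc_last, Matrix.cons_val, finitePoint_coe] at h
  obtain ⟨e, he⟩ := h ⟨by simp, by rw [onLine_iff (by simp)]; norm_num [h₀.ne']⟩
  exact not_cong_of_finite h₀ hε e he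

theorem not_force_nonuniformCircumscription (h₀ : 0 < ε) (hε : ∀ n : ℕ, n * ε < 1) :
    ¬ nonuniformCircumscription.Force (plane (finiteElements F)) (Fin.elim0 : Fin 0 → _) := by
  intro h
  have h₁ : ε < 1 := by simpa using hε 1
  rw [nonuniformCircumscription, Form.force_close] at h
  have h := (h.1 ![finitePoint 1 0 (by norm_num) (by simp), finitePoint 2 0 (by simp) (by simp),
    finitePoint 0 ε (by simp) (by rw [abs_of_pos] <;> linarith)]).1
  simp only [Form.Force, Form.Realize, hasCenter, force_cong, Form.force_neg,
    realize_on, Fin.snoc_castSucc, Fin.snoc_last, Matrix.cons_val, finitePoint_coe] at h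
  obtain ⟨e, he⟩ := h fun h => by
    have h := h.2.2.2
    rw [onLine_iff (by simp)] at h
    norm_num [h₀.ne'] at h
  exact not_cong_of_finite h₀ hε e he

theorem not_force_strongCircumscription (h₀ : 0 < ε) (hε : ∀ n : ℕ, n * ε < 1) :
    ¬ strongCircumscription.Force (plane (finiteElements F)) (Fin.elim0 : Fin 0 → _) := by
  intro h
  have h₁ : ε < 1 := by simpa using hε 1
  rw [strongCircumscription, Form.force_close] at h
  have h := (h.1 ![finitePoint 1 0 (by norm_num) (by simp), finitePoint 2 0 (by simp) (by simp),
    finitePoint 1 0 (by norm_num) (by simp), finitePoint 2 0 (by simp) (by simp),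
    finitePoint 0 ε (by simp) (by rw [abs_of_pos] <;> linarith)]).1
  simp only [Form.Force, hasStrongCenter, force_cong, force_ne, Form.force_neg, force_on,
    realize_on, Fin.snoc_castSucc, Fin.snoc_last, Matrix.cons_val, finitePoint_coe] at h
  obtain ⟨e, he₁, he₂, -⟩ := h ⟨by simp, by rw [onLine_iff (by simp)]; norm_num,
    by rw [onLine_iff (by simp)]; norm_num, by rw [onLine_iff (by simp)]; norm_num [h₀.ne']⟩
  exact not_cong_of_finite h₀ hε e ⟨he₁, he₂⟩

theorem not_force_oneSidedCircumscription (h₀ : 0 < ε) (hε : ∀ n : ℕ, n * ε < 1) :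
    ¬ oneSidedCircumscription.Force (plane (finiteElements F)) (Fin.elim0 : Fin 0 → _) := by
  intro h
  have h₁ : ε < 1 := by simpa using hε 1
  rw [oneSidedCircumscription, Form.force_close] at h
  -- The perpendicular from `c = (0, ε)` is the `y`-axis, with foot at the origin witnessed by `(-1,
  -- 0)` and `(1, 0)`. Both `a` and `b` lie to its right.
  have h := (h.1 ![finitePoint 1 0 (by norm_num) (by simp), finitePoint 2 0 (by simp) (by simp),
    finitePoint 1 0 (by norm_num) (by simp), finitePoint 2 0 (by simp) (by simp),
    finitePoint 0 ε (by simp) (by rw [abs_of_pos] <;> linarith),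
    finitePoint 0 0 (by simp) (by simp), finitePoint (-1) 0 (by norm_num) (by simp),
    finitePoint 1 0 (by norm_num) (by simp)]).1
  simp only [Form.Force, Form.Realize, hasStrongCenter, force_cong, force_ne, Form.force_neg,
    force_on, force_bet, realize_on, realize_bet, Fin.snoc_castSucc, Fin.snoc_last,
    Matrix.cons_val, finitePoint_coe] at h
  obtain ⟨e, he₁, he₂, -⟩ := h ⟨by simp, by rw [onLine_iff (by simp)]; norm_num,
    by rw [onLine_iff (by simp)]; norm_num, by rw [onLine_iff (by simp)]; norm_num [h₀.ne'],
    by rw [onLine_iff (by simp)]; norm_num, by rw [onLine_iff (by simp)]; norm_num,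
    by rw [onLine_iff (by simp)]; norm_num, by rw [bet_iff, Between]; constructor <;> norm_num,
    by simp [cong_iff, sqDist], by simp [cong_iff, sqDist], by
      rintro ⟨x, hx₁, hx₂, hx₃⟩
      rw [onLine_iff (by simp [h₀.ne'])] at hx₁
      have hx : x.1 = 0 := by simpa [h₀.ne'] using hx₁
      simp [hx] at hx₂ hx₃
      nlinarith [mul_self_nonneg x.2]⟩
  exact not_cong_of_finite h₀ hε e ⟨he₁, he₂⟩

end Infinitesimal

/-! ### Euclidean fields with infinitesimals -/

theorem exists_sqrt_hyperreal (x : ℝ*) (hx : 0 ≤ x) : ∃ z : ℝ*, 0 ≤ z ∧ z * z = x := by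
  induction x using Filter.Germ.inductionOn with
  | _ f =>
    -- Roots are taken pointwise. Where `f n` is negative the value is `0`, which does no harm since
    -- this happens outside a set of the ultrafilter.
    refine ⟨((fun n => √(f n) : ℕ → ℝ) : Filter.Germ (Filter.hyperfilter ℕ : Filter ℕ) ℝ), ?_, ?_⟩
    · exact Filter.Germ.coe_le.2 (.of_forall fun n => Real.sqrt_nonneg _)
    · refine Filter.Germ.coe_eq.2 ?_
      filter_upwards [Filter.Germ.coe_le.1 hx] with n hn
      exact Real.mul_self_sqrt hn

theorem natCast_mul_epsilon_lt_one (n : ℕ) : (n : ℝ*) * Hyperreal.epsilon < 1 := by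
  -- Comparing with `1 / (n + 1)` rather than `1 / n` spares the case `n = 0`.
  have h : Hyperreal.epsilon < (((n + 1 : ℝ)⁻¹ : ℝ) : ℝ*) := Hyperreal.epsilon_lt_of_pos (by positivity)
  have h' := mul_lt_mul_of_pos_left h (show (0 : ℝ*) < n + 1 by positivity)
  have e : ((n : ℝ*) + 1) * (((n + 1 : ℝ)⁻¹ : ℝ) : ℝ*) = 1 := by
    push_cast
    exact mul_inv_cancel₀ (by positivity)
  nlinarith [Hyperreal.epsilon_pos]

/-- If `ψ` fails at the root of the Kripke model of finite hyperreal points, then Playfair's axiom does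
not imply `ψ`. -/
theorem not_proves_playfair_imp {T : Set (Form geo 0)} (hT : SoundInPlayfairRings T)
    {ψ : Form geo 0}
    (hψ : ¬ ψ.Force (plane (finiteElements ℝ*)) (Fin.elim0 : Fin 0 → _)) :
    ¬ Proves T (playfair ⇛ ψ) := by
  intro h
  have : Nonempty (finiteElements ℝ*) := ⟨0, 0, by simp⟩
  have : Nonempty (plane (finiteElements ℝ*)) := ⟨finitePoint 0 0 (by simp) (by simp)⟩
  refine hψ ((h.force (S := plane (finiteElements ℝ*)) (fun φ hφ => ?_) Fin.elim0 (by simp)).1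
    (playfair_plane).force)
  have := (hT φ hφ).force (S := finiteElements ℝ*)
    (fun _ h => force_playfairRings exists_sqrt_hyperreal h)
    (coords fun i => toPair ((Fin.elim0 : Fin 0 → plane (finiteElements ℝ*)) i)) (by simp)
  exact (force_bar φ _).1 this

/-! ### Countability of the set of formulas of the language of geometry -/

namespace Form

/-- The height of the syntax tree of a formula. -/
def height {L : FirstOrder.Language.{0, 0}} : {n : ℕ} → Form L n → ℕ
  | _, falsum => 0
  | _, equal _ _ => 0
  | _, rel _ _ => 0
  | _, and φ ψ => max φ.height ψ.height + 1
  | _, or φ ψ => max φ.height ψ.height + 1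
  | _, imp φ ψ => max φ.height ψ.height + 1
  | _, all φ => φ.height + 1
  | _, ex φ => φ.height + 1

theorem geoTerm_eq_var {n : ℕ} (t : geo.Term (Fin n)) : t = Term.var (geoVar t) := by
  cases t with
  | var i => rfl
  | func f ts => exact nomatch f

instance {n : ℕ} : Countable (geo.Term (Fin n)) :=
  Function.Injective.countable (f := geoVar) fun s t h => by
    rw [geoTerm_eq_var s, geoTerm_eq_var t, h]

/-- Each arity has at most one relation symbol, so a constant map is injective. -/
instance {l : ℕ} : Countable (geo.Relations l) :=
  Function.Injective.countable (f := fun _ => 0) fun (R : GeoRel l) S _ => by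
    cases R <;> cases S <;> rfl

/-- The induction on height is uniform in `n` because quantifiers pass to formulas with one more
variable. Each constructor contributes a countable image. -/
theorem countable_height_lt (k : ℕ) : ∀ n : ℕ, {φ : Form geo n | φ.height < k}.Countable := by
  induction k with
  | zero => simp
  | succ k ih =>
    intro n
    have hr : (⋃ l, Set.range fun p : geo.Relations l × (Fin l → geo.Term (Fin n)) =>
        rel p.1 p.2).Countable := Set.countable_iUnion fun l => Set.countable_range _
    refine Set.Countable.mono (fun φ (hφ : φ.height < k + 1) => ?_)
      ((Set.countable_singleton (falsum : Form geo n)).union <|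
      (Set.countable_range fun p : geo.Term (Fin n) × geo.Term (Fin n) => equal p.1 p.2).union <|
      hr.union <| ((ih n).image2 (ih n) and).union <| ((ih n).image2 (ih n) or).union <|
      ((ih n).image2 (ih n) imp).union <| ((ih (n + 1)).image all).union <|
      (ih (n + 1)).image ex)
    cases φ with
    | falsum => exact .inl rfl
    | equal s t => exact .inr (.inl ⟨(s, t), rfl⟩)
    | @rel _ l R ts => exact .inr (.inr (.inl (Set.mem_iUnion.2 ⟨l, (R, ts), rfl⟩)))
    | and φ ψ =>
      rw [height, Nat.add_lt_add_iff_right, max_lt_iff] at hφ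
      exact .inr (.inr (.inr (.inl ⟨φ, hφ.1, ψ, hφ.2, rfl⟩)))
    | or φ ψ =>
      rw [height, Nat.add_lt_add_iff_right, max_lt_iff] at hφ
      exact .inr (.inr (.inr (.inr (.inl ⟨φ, hφ.1, ψ, hφ.2, rfl⟩))))
    | imp φ ψ =>
      rw [height, Nat.add_lt_add_iff_right, max_lt_iff] at hφ
      exact .inr (.inr (.inr (.inr (.inr (.inl ⟨φ, hφ.1, ψ, hφ.2, rfl⟩)))))
    | all φ =>
      rw [height, Nat.add_lt_add_iff_right] at hφ
      exact .inr (.inr (.inr (.inr (.inr (.inr (.inl ⟨φ, hφ, rfl⟩))))))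
    | ex φ =>
      rw [height, Nat.add_lt_add_iff_right] at hφ
      exact .inr (.inr (.inr (.inr (.inr (.inr (.inr ⟨φ, hφ, rfl⟩))))))

instance {n : ℕ} : Countable (Form geo n) := by
  rw [← Set.countable_univ_iff]
  refine (Set.countable_iUnion fun k => countable_height_lt k n).mono fun φ _ => ?_
  exact Set.mem_iUnion.2 ⟨φ.height + 1, Nat.lt_succ_self _⟩

/-- The formula `φ` about the variables numbered by `e`. -/
def at_ {m n : ℕ} (φ : Form geo m) (e : Fin m → ℕ) (h : ∀ i, e i < n) : Form geo n :=
  φ.subst fun i => Term.var ⟨e i, h i⟩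

theorem at_val {n : ℕ} (φ : Form geo n) : φ.at_ Fin.val Fin.isLt = φ := φ.subst_var

theorem at_subst_castLE {m n k : ℕ} (φ : Form geo m) (e : Fin m → ℕ) (h : ∀ i, e i < n)
    (hk : n ≤ k) : (φ.at_ e h).subst (fun i => Term.var (Fin.castLE hk i)) =
      φ.at_ e fun i => (h i).trans_le hk :=
  φ.subst_subst _ _

theorem snoc_lt {m n : ℕ} {e : Fin m → ℕ} (h : ∀ i, e i < n) {j : ℕ} (hj : j < n) (i : Fin (m + 1)) :
    Fin.snoc (α := fun _ : Fin (m + 1) => ℕ) e j i < n := by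
  refine Fin.lastCases ?_ (fun i => ?_) i
  · simpa
  · simpa using h i

theorem at_snoc {m n : ℕ} (φ : Form geo (m + 1)) {e : Fin m → ℕ} (h : ∀ i, e i < n) {j : ℕ}
    (hj : j < n) : φ.at_ (Fin.snoc (α := fun _ : Fin (m + 1) => ℕ) e j) (snoc_lt h hj) =
      (φ.subst (liftSubst fun i => Term.var ⟨e i, h i⟩)).inst (Term.var ⟨j, hj⟩) := by
  rw [subst_inst_liftSubst, at_]
  congr 1
  funext i
  refine Fin.lastCases ?_ (fun i => ?_) i <;> simp

/-- Bookkeeping for existential witnesses: the eigenvariable of an existential in a context with `n`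
variables receives the number `n`. -/
theorem at_snoc_fresh {m n : ℕ} (φ : Form geo (m + 1)) {e : Fin m → ℕ} (h : ∀ i, e i < n) :
    φ.at_ (Fin.snoc (α := fun _ : Fin (m + 1) => ℕ) e n)
      (snoc_lt (fun i => (h i).trans n.lt_succ_self) n.lt_succ_self) =
      φ.subst (liftSubst fun i => Term.var ⟨e i, h i⟩) := by
  rw [at_]
  congr 1
  funext i
  refine Fin.lastCases ?_ (fun i => ?_) i
  · rw [liftSubst_last]
    exact congrArg Term.var (Fin.ext (by simp))
  · simp [Term.relabel]

end Form

/-! ### Generic models of consistent sets of assumptions -/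

/-- A consistent finite set of assumptions. -/
structure ConsistentState (T : Set (Form geo 0)) where
  /-- the number of variables -/
  n : ℕ
  /-- the assumptions -/
  Γ : List (Form geo n)
  consistent : ¬ Derives T Γ Form.falsum

namespace ConsistentState

variable {T : Set (Form geo 0)}

instance : Preorder (ConsistentState T) where
  le s t := ∃ h : s.n ≤ t.n,
    ∀ γ ∈ s.Γ, γ.subst (fun i => Term.var (Fin.castLE h i)) ∈ t.Γ
  le_refl s := ⟨le_rfl, fun γ hγ => by
    have : γ.subst (fun i => Term.var (Fin.castLE le_rfl i)) = γ := γ.subst_var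
    rwa [this]⟩
  le_trans s t r h h' := by
    obtain ⟨h₁, h₂⟩ := h
    obtain ⟨h₁', h₂'⟩ := h'
    refine ⟨h₁.trans h₁', fun γ hγ => ?_⟩
    have := h₂' _ (h₂ γ hγ)
    rwa [Form.subst_subst] at this

/-- Derivability survives extending the context: rename the variables, then weaken. -/
theorem derives_of_le {s t : ConsistentState T} (hst : s ≤ t) {m : ℕ} {φ : Form geo m}
    {e : Fin m → ℕ} (h : ∀ i, e i < s.n) (hφ : Derives T s.Γ (φ.at_ e h)) :
    Derives T t.Γ (φ.at_ e fun i => (h i).trans_le hst.1) := by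
  have := hφ.subst fun i => Term.var (Fin.castLE hst.1 i)
  rw [Form.at_subst_castLE] at this
  exact this.weakening fun _ hγ => by
    obtain ⟨γ, hγs, rfl⟩ := List.mem_map.1 hγ
    exact hst.2 γ hγs

/-- Adding a variable. -/
def fresh (s : ConsistentState T) : ConsistentState T where
  n := s.n + 1
  Γ := s.Γ.map Form.weaken
  consistent h := s.consistent (.exE .nonempty (h.weakening (List.subset_cons_self _ _)))

theorem le_fresh (s : ConsistentState T) : s ≤ s.fresh :=
  ⟨Nat.le_succ _, fun _ hγ => List.mem_map_of_mem hγ⟩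

theorem exists_le_n (s : ConsistentState T) (N : ℕ) : ∃ t, s ≤ t ∧ N ≤ t.n := by
  induction N with
  | zero => exact ⟨s, le_rfl, Nat.zero_le _⟩
  | succ N ih =>
    obtain ⟨t, hst, ht⟩ := ih
    exact ⟨t.fresh, hst.trans t.le_fresh, Nat.succ_le_succ ht⟩

theorem exists_forall_lt (s : ConsistentState T) {m : ℕ} (e : Fin m → ℕ) :
    ∃ t, s ≤ t ∧ ∀ i, e i < t.n := by
  obtain ⟨t, hst, ht⟩ := s.exists_le_n (Finset.univ.sup e + 1)
  exact ⟨t, hst, fun i => (Nat.lt_succ_of_le (Finset.le_sup (Finset.mem_univ i))).trans_le ht⟩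

/-- Adding a consistent assumption. -/
def add (s : ConsistentState T) (φ : Form geo s.n) (h : ¬ Derives T (φ :: s.Γ) Form.falsum) :
    ConsistentState T where
  n := s.n
  Γ := φ :: s.Γ
  consistent := h

theorem le_add (s : ConsistentState T) (φ : Form geo s.n)
    (h : ¬ Derives T (φ :: s.Γ) Form.falsum) : s ≤ s.add φ h :=
  ⟨le_rfl, fun γ hγ => by
    have : γ.subst (fun i => Term.var (Fin.castLE le_rfl i)) = γ := γ.subst_var
    exact List.mem_cons_of_mem _ (this.symm ▸ hγ : _ ∈ s.Γ)⟩

/-- Adding a witness of a consistent existential formula. -/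
def addWitness (s : ConsistentState T) (φ : Form geo (s.n + 1)) (h : Derives T s.Γ φ.ex) :
    ConsistentState T where
  n := s.n + 1
  Γ := φ :: s.Γ.map Form.weaken
  consistent h' := s.consistent (.exE h h')

theorem le_addWitness (s : ConsistentState T) (φ : Form geo (s.n + 1))
    (h : Derives T s.Γ φ.ex) : s ≤ s.addWitness φ h :=
  ⟨Nat.le_succ _, fun _ hγ => List.mem_cons_of_mem _ (List.mem_map_of_mem hγ)⟩

/-- The state decides the formula `φ` about the variables `e`, with a witness if `φ` is a true
existential formula. -/
def Decides (s : ConsistentState T) {m : ℕ} (φ : Form geo m) (e : Fin m → ℕ) : Prop :=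
  ∃ h : ∀ i, e i < s.n, Derives T s.Γ (φ.at_ e h).neg ∨
    Derives T s.Γ (φ.at_ e h) ∧ ∀ ψ : Form geo (m + 1), φ = ψ.ex → ∃ (j : ℕ) (hj : j < s.n),
      Derives T s.Γ (ψ.at_ (Fin.snoc (α := fun _ : Fin (m + 1) => ℕ) e j) (Form.snoc_lt h hj))

theorem exists_decides (s : ConsistentState T) {m : ℕ} (φ : Form geo m) (e : Fin m → ℕ) :
    ∃ t, t.Decides φ e ∧ s ≤ t := by
  obtain ⟨t, hst, h⟩ := s.exists_forall_lt e
  -- Either the formula is refuted already, or it can be added consistently. An added existential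
  -- formula gets a fresh witness at once.
  by_cases hc : Derives T (φ.at_ e h :: t.Γ) Form.falsum
  · exact ⟨t, ⟨h, .inl (.impI hc)⟩, hst⟩
  have ht := t.le_add _ hc
  have hφ : Derives T (t.add _ hc).Γ (φ.at_ e h) := .hyp List.mem_cons_self
  by_cases hψ : ∃ ψ, φ = Form.ex ψ
  · obtain ⟨ψ, rfl⟩ := hψ
    refine ⟨(t.add _ hc).addWitness _ hφ, ⟨fun i => (h i).trans t.n.lt_succ_self, .inr ⟨?_, ?_⟩⟩,
      (hst.trans ht).trans (le_addWitness _ _ _)⟩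
    · exact derives_of_le (le_addWitness _ _ hφ) h hφ
    · rintro _ ⟨⟩
      refine ⟨t.n, t.n.lt_succ_self, ?_⟩
      have := Form.at_snoc_fresh ψ h
      exact .hyp (List.mem_cons.2 (.inl this))
  · exact ⟨t.add _ hc, ⟨h, .inr ⟨hφ, fun ψ hψ' => (hψ ⟨ψ, hψ'⟩).elim⟩⟩, hst.trans ht⟩

/-- The ideal decides all formulas. -/
def _root_.ConstructiveGeometry.IsGeneric (I : Order.Ideal (ConsistentState T)) : Prop :=
  ∀ (m : ℕ) (φ : Form geo m) (e : Fin m → ℕ), ∃ t ∈ I, t.Decides φ e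

/-- Every consistent state belongs to an ideal that decides all formulas. -/
theorem exists_generic (s : ConsistentState T) : ∃ I : Order.Ideal (ConsistentState T), s ∈ I ∧ IsGeneric I := by
  let ι := Σ m, Form geo m × (Fin m → ℕ)
  -- Countability of the formulas is what allows all the dense sets to be met successively, as in
  -- the Rasiowa–Sikorski lemma.
  let _ : Encodable ι := Encodable.ofCountable ι
  let D : ι → Order.Cofinal (ConsistentState T) := fun p =>
    ⟨{t | t.Decides p.2.1 p.2.2}, fun s => s.exists_decides _ _⟩
  refine ⟨Order.idealOfCofinals s D, Order.mem_idealOfCofinals s D, fun m φ e => ?_⟩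
  obtain ⟨t, ht, htI⟩ := Order.cofinal_meets_idealOfCofinals s D ⟨m, φ, e⟩
  exact ⟨t, htI, ht⟩

end ConsistentState

/-- A formula is derivable in an ideal of states. -/
def Holds {T : Set (Form geo 0)} (I : Order.Ideal (ConsistentState T)) {m : ℕ} (φ : Form geo m)
    (e : Fin m → ℕ) : Prop :=
  ∃ s ∈ I, ∃ h : ∀ i, e i < s.n, Derives T s.Γ (φ.at_ e h)

/-! ### Derivability along a generic ideal -/

namespace Holds

open ConsistentState

variable {T : Set (Form geo 0)} {I : Order.Ideal (ConsistentState T)}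

/-- Two facts known at different states hold together at a common extension in the ideal, where they
can be combined by a derivation. -/
theorem map₂ {m k l : ℕ} {φ : Form geo m} {e : Fin m → ℕ} {ψ : Form geo k} {f : Fin k → ℕ}
    {χ : Form geo l} {g : Fin l → ℕ} (hφ : Holds I φ e) (hψ : Holds I ψ f)
    (h : ∀ (n : ℕ) (Γ : List (Form geo n)) (he : ∀ i, e i < n) (hf : ∀ i, f i < n),
      Derives T Γ (φ.at_ e he) → Derives T Γ (ψ.at_ f hf) →
      ∃ hg : ∀ i, g i < n, Derives T Γ (χ.at_ g hg)) : Holds I χ g := by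
  obtain ⟨s, hs, he, hφ⟩ := hφ
  obtain ⟨t, ht, hf, hψ⟩ := hψ
  obtain ⟨r, hr, hsr, htr⟩ := I.directed s hs t ht
  exact ⟨r, hr, h _ _ _ _ (derives_of_le hsr he hφ) (derives_of_le htr hf hψ)⟩

theorem map {m k : ℕ} {φ : Form geo m} {e : Fin m → ℕ} {ψ : Form geo k} {f : Fin k → ℕ}
    (hφ : Holds I φ e)
    (h : ∀ (n : ℕ) (Γ : List (Form geo n)) (he : ∀ i, e i < n), Derives T Γ (φ.at_ e he) →
      ∃ hf : ∀ i, f i < n, Derives T Γ (ψ.at_ f hf)) : Holds I ψ f :=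
  map₂ hφ hφ fun n Γ he _ h₁ _ => h n Γ he h₁

theorem not_falsum {m : ℕ} (e : Fin m → ℕ) : ¬ Holds I Form.falsum e := by
  rintro ⟨s, -, h, hs⟩
  exact s.consistent hs

theorem or_neg (hI : IsGeneric I) {m : ℕ} (φ : Form geo m) (e : Fin m → ℕ) : Holds I φ e ∨ Holds I φ.neg e := by
  obtain ⟨t, ht, h, h' | ⟨h', -⟩⟩ := hI m φ e
  · exact .inr ⟨t, ht, h, h'⟩
  · exact .inl ⟨t, ht, h, h'⟩

theorem of_derives (hI : IsGeneric I) {m : ℕ} {φ : Form geo m} (e : Fin m → ℕ)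
    (h : ∀ (n : ℕ) (Γ : List (Form geo n)) (he : ∀ i, e i < n), Derives T Γ (φ.at_ e he)) :
    Holds I φ e := by
  obtain ⟨t, ht, he, -⟩ := hI m φ e
  exact ⟨t, ht, he, h _ _ _⟩

/-- A trivial truth, used with `map₂` to reach a state in which all the variables `e i` are in
scope. -/
theorem neg_falsum (hI : IsGeneric I) {m : ℕ} (e : Fin m → ℕ) :
    Holds I (Form.falsum (n := m)).neg e :=
  of_derives hI _ fun _ _ _ => .impI (.hyp List.mem_cons_self)

theorem and_iff {m : ℕ} {φ ψ : Form geo m} {e : Fin m → ℕ} :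
    Holds I (φ ⋏ ψ) e ↔ Holds I φ e ∧ Holds I ψ e :=
  ⟨fun h => ⟨h.map fun _ _ he h => ⟨he, .andE₁ h⟩, h.map fun _ _ he h => ⟨he, .andE₂ h⟩⟩,
    fun h => h.1.map₂ h.2 fun _ _ he _ h₁ h₂ => ⟨he, .andI h₁ h₂⟩⟩

/-- Genericity decides the antecedent: if it fails, its negation yields the implication by ex falso.
-/
theorem imp_iff (hI : IsGeneric I) {m : ℕ} {φ ψ : Form geo m} {e : Fin m → ℕ} :
    Holds I (φ ⇛ ψ) e ↔ (Holds I φ e → Holds I ψ e) := by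
  refine ⟨fun h h' => h.map₂ h' fun _ _ he _ h₁ h₂ => ⟨he, .impE h₁ h₂⟩, fun h => ?_⟩
  rcases or_neg hI φ e with h' | h'
  · exact (h h').map fun _ _ he h₁ => ⟨he, .impI (h₁.weakening (List.subset_cons_self _ _))⟩
  · exact h'.map fun _ _ he h₁ => ⟨he, .impI (.falsumE (.impE
      (h₁.weakening (List.subset_cons_self _ _)) (.hyp List.mem_cons_self)))⟩

theorem or_iff (hI : IsGeneric I) {m : ℕ} {φ ψ : Form geo m} {e : Fin m → ℕ} :
    Holds I (φ ⋎ ψ) e ↔ Holds I φ e ∨ Holds I ψ e := by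
  refine ⟨fun h => or_iff_not_imp_left.2 fun h₁ => ?_, fun h => ?_⟩
  · exact h.map₂ ((or_neg hI φ e).resolve_left h₁) fun _ _ he _ h h' => ⟨he, .orE h
      (.falsumE (.impE (h'.weakening (List.subset_cons_self _ _)) (.hyp List.mem_cons_self)))
      (.hyp List.mem_cons_self)⟩
  · rcases h with h | h
    · exact h.map fun _ _ he h₁ => ⟨he, .orI₁ h₁⟩
    · exact h.map fun _ _ he h₁ => ⟨he, .orI₂ h₁⟩

theorem ex_iff (hI : IsGeneric I) {m : ℕ} {φ : Form geo (m + 1)} {e : Fin m → ℕ} :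
    Holds I φ.ex e ↔ ∃ j, Holds I φ (Fin.snoc (α := fun _ : Fin (m + 1) => ℕ) e j) := by
  constructor
  · intro hφ
    obtain ⟨t, ht, h, h' | ⟨-, h'⟩⟩ := hI m φ.ex e
    · have hn : Holds I φ.ex.neg e := ⟨t, ht, h, h'⟩
      exact (not_falsum e ((imp_iff hI).1 hn hφ)).elim
    · obtain ⟨j, hj, hφ'⟩ := h' φ rfl
      exact ⟨j, t, ht, _, hφ'⟩
  · rintro ⟨j, hj⟩
    refine hj.map fun n Γ he h => ?_
    have hm : ∀ i, e i < n := fun i => by simpa using he i.castSucc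
    have hjn : j < n := by simpa using he (Fin.last m)
    refine ⟨hm, .exI (Term.var ⟨j, hjn⟩) ?_⟩
    rwa [← Form.at_snoc φ hm hjn]

/-- The converse is not available: a generic ideal may contain the negation of a universal formula
without any counterexample. The equation `hj` only brings the variable `j` into scope. -/
theorem all_inst (hI : IsGeneric I) {m : ℕ} {φ : Form geo (m + 1)} {e : Fin m → ℕ} (h : Holds I φ.all e) (j : ℕ) :
    Holds I φ (Fin.snoc (α := fun _ : Fin (m + 1) => ℕ) e j) := by
  have hj : Holds I (eqPt 0 0 : Form geo 1) (fun _ => j) := of_derives hI _ fun _ _ _ => .eqRefl _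
  refine h.map₂ hj fun n Γ hm hj h _ => ⟨Form.snoc_lt hm (hj 0), ?_⟩
  rw [Form.at_snoc φ hm (hj 0)]
  exact .allE h _

/-- Equality of variables in a generic model. -/
def Eqv (I : Order.Ideal (ConsistentState T)) (a b : ℕ) : Prop :=
  Holds I (eqPt 0 1 : Form geo 2) ![a, b]

/-- The equivalence relation on variables in a generic model. -/
def setoid (hI : IsGeneric I) : Setoid ℕ where
  r := Eqv I
  iseqv :=
    { refl := fun a => of_derives hI _ fun _ _ _ => .eqRefl _
      symm := fun {a b} h => h.map fun n Γ he h => by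
        have ha : a < n := he 0
        have hb : b < n := he 1
        exact ⟨fun i => by fin_cases i <;> assumption, Derives.eqSymm h⟩
      trans := fun {a b c} h h' => h.map₂ h' fun n Γ he hf h h' => by
        have ha : a < n := he 0
        have hb : c < n := hf 1
        exact ⟨fun i => by fin_cases i <;> assumption, Derives.eqTrans h h'⟩ }

theorem update_of_eqv {m : ℕ} {φ : Form geo m} {e : Fin m → ℕ} (h : Holds I φ e) (i : Fin m)
    {b : ℕ} (hb : Eqv I (e i) b) : Holds I φ (Function.update e i b) := by
  refine h.map₂ hb fun n Γ he hf h h' => ?_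
  have hbn : b < n := hf 1
  have hu : ∀ j, Function.update e i b j < n := fun j => by
    rcases eq_or_ne j i with rfl | hj
    · simpa using hbn
    · simpa [hj] using he j
  refine ⟨hu, ?_⟩
  -- The place `i` is opened up as a new last variable, so that the equality rule replaces this
  -- occurrence only.
  let ψ : Form geo (n + 1) := φ.subst fun j =>
    if j = i then Term.var (Fin.last n) else Term.var (Fin.castSucc ⟨e j, he j⟩)
  have h₁ : ψ.inst (Term.var ⟨e i, he i⟩) = φ.at_ e he := by
    rw [Form.inst, Form.subst_subst, Form.at_]
    congr 1
    funext j
    rcases eq_or_ne j i with rfl | hj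
    · simp [Term.subst]
    · simp only [if_neg hj, Term.subst]
      exact Fin.snoc_castSucc (α := fun _ => geo.Term (Fin n)) _ _ _
  have h₂ : ψ.inst (Term.var ⟨b, hbn⟩) = φ.at_ (Function.update e i b) hu := by
    rw [Form.inst, Form.subst_subst, Form.at_]
    congr 1
    funext j
    rcases eq_or_ne j i with rfl | hj
    · simp [Term.subst]
    · simp only [if_neg hj, Term.subst, Function.update_of_ne hj]
      exact Fin.snoc_castSucc (α := fun _ => geo.Term (Fin n)) _ _ _
  rw [← h₂]
  exact .eqSubst ψ h' (h₁ ▸ h)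

theorem of_eqv {m : ℕ} {φ : Form geo m} {e f : Fin m → ℕ} (h : Holds I φ e)
    (hef : ∀ i, Eqv I (e i) (f i)) : Holds I φ f := by
  have key : ∀ s : Finset (Fin m), Holds I φ fun i => if i ∈ s then f i else e i := by
    intro s
    induction s using Finset.induction_on with
    | empty => simpa using h
    | insert a s ha ih =>
      convert ih.update_of_eqv a (b := f a) (by simpa [ha] using hef a) using 1
      funext i
      rcases eq_or_ne i a with rfl | hi
      · simp
      · simp [hi]
  simpa using key Finset.univ

end Holds

/-! ### Truth in a generic model -/

/-- The domain of a generic model. -/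
def GenericModel {T : Set (Form geo 0)} {I : Order.Ideal (ConsistentState T)}
    (hI : IsGeneric I) : Type := Quotient (Holds.setoid hI)

section GenericModel

variable {T : Set (Form geo 0)} {I : Order.Ideal (ConsistentState T)} {hI : IsGeneric I}

/-- The element of a generic model denoted by a variable. -/
def GenericModel.mk (a : ℕ) : GenericModel hI := Quotient.mk _ a

theorem GenericModel.mk_eq_mk {a b : ℕ} :
    (GenericModel.mk a : GenericModel hI) = GenericModel.mk b ↔ Holds.Eqv I a b :=
  Quotient.eq (r := Holds.setoid hI)

theorem GenericModel.mk_out (x : GenericModel hI) : GenericModel.mk (Quotient.out x) = x :=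
  Quotient.out_eq x

instance : geo.Structure (GenericModel hI) where
  funMap := fun {_} f => nomatch f
  RelMap := fun {_} R x => Holds I (Form.rel R Term.var) fun i => Quotient.out (x i)

namespace Form

/-- Formulas without universal quantifiers. -/
def AllFree : {n : ℕ} → Form geo n → Prop
  | _, falsum => True
  | _, equal _ _ => True
  | _, rel _ _ => True
  | _, and φ ψ => φ.AllFree ∧ ψ.AllFree
  | _, or φ ψ => φ.AllFree ∧ ψ.AllFree
  | _, imp φ ψ => φ.AllFree ∧ ψ.AllFree
  | _, all _ => False
  | _, ex φ => φ.AllFree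

/-- Formulas in which universal quantifiers are positive and outside of existential ones. -/
def PosAll : {n : ℕ} → Form geo n → Prop
  | _, and φ ψ => φ.PosAll ∧ ψ.PosAll
  | _, imp φ ψ => φ.AllFree ∧ ψ.PosAll
  | _, all φ => φ.PosAll
  | _, φ => φ.AllFree

theorem mk_snoc {n : ℕ} (e : Fin n → ℕ) (j : ℕ) :
    (fun i => (GenericModel.mk (Fin.snoc (α := fun _ : Fin (n + 1) => ℕ) e j i) : GenericModel hI)) =
      Fin.snoc (α := fun _ : Fin (n + 1) => GenericModel hI) (fun i => GenericModel.mk (e i))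
        (GenericModel.mk j) := by
  funext i
  refine Fin.lastCases ?_ (fun i => ?_) i <;> simp

/-- Genericity makes derivability commute with all connectives and with existential quantifiers.
Representatives chosen in the quotient are exchanged by `Holds.of_eqv`. -/
theorem realize_iff_holds {n : ℕ} {φ : Form geo n} (hφ : φ.AllFree) (e : Fin n → ℕ) :
    φ.Realize (fun i => (GenericModel.mk (e i) : GenericModel hI)) ↔ Holds I φ e := by
  induction φ with
  | falsum => exact ⟨False.elim, Holds.not_falsum e⟩
  | equal s t =>
    rw [Realize, geoTerm_eq_var s, geoTerm_eq_var t]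
    refine GenericModel.mk_eq_mk.trans ⟨fun h => ?_, fun h => ?_⟩
    · exact h.map₂ (Holds.neg_falsum hI e) fun n Γ _ he h _ => ⟨he, h⟩
    · exact h.map fun n Γ he h => ⟨fun i => by fin_cases i <;> exact he _, h⟩
  | rel R ts =>
    have h₁ : Holds I (rel R ts) e ↔ Holds I (rel R Term.var) fun i => e (geoVar (ts i)) := by
      have h₂ : ∀ (n : ℕ) (he : ∀ i, e i < n), (rel R ts).at_ e he =
          (rel R Term.var).at_ (fun i => e (geoVar (ts i))) fun i => he _ := fun n he => by
        refine congrArg (rel R) (funext fun i => ?_)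
        rw [geoTerm_eq_var (ts i)]
        rfl
      refine ⟨fun h => h.map fun n Γ he h => ⟨fun i => he _, h₂ n he ▸ h⟩, fun h => ?_⟩
      exact h.map₂ (Holds.neg_falsum hI e) fun n Γ _ he h _ => ⟨he, (h₂ n he).symm ▸ h⟩
    rw [h₁, Realize]
    simp only [realize_geoVar]
    refine ⟨fun h => h.of_eqv fun i => ?_, fun h => h.of_eqv fun i => ?_⟩
    · exact GenericModel.mk_eq_mk.1 (GenericModel.mk_out _)
    · exact GenericModel.mk_eq_mk.1 (GenericModel.mk_out _).symm
  | and φ ψ h₁ h₂ => rw [Realize, h₁ hφ.1, h₂ hφ.2, Holds.and_iff]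
  | or φ ψ h₁ h₂ => rw [Realize, h₁ hφ.1, h₂ hφ.2, Holds.or_iff hI]
  | imp φ ψ h₁ h₂ => rw [Realize, h₁ hφ.1, h₂ hφ.2, Holds.imp_iff hI]
  | all φ ih => exact hφ.elim
  | ex φ ih =>
    rw [Holds.ex_iff hI]
    constructor
    · rintro ⟨x, hx⟩
      refine ⟨Quotient.out x, (ih hφ _).1 ?_⟩
      rwa [mk_snoc, GenericModel.mk_out]
    · rintro ⟨j, hj⟩
      refine ⟨GenericModel.mk j, ?_⟩
      rw [← mk_snoc]
      exact (ih hφ _).2 hj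

/-- Universal quantifiers need only instantiation in this direction. An antecedent has to be
translated backwards, which is why it must be free of them. -/
theorem realize_of_holds {n : ℕ} {φ : Form geo n} (hφ : φ.PosAll) (e : Fin n → ℕ)
    (h : Holds I φ e) : φ.Realize fun i => (GenericModel.mk (e i) : GenericModel hI) := by
  induction φ with
  | falsum => exact (realize_iff_holds hφ e).2 h
  | equal s t => exact (realize_iff_holds hφ e).2 h
  | rel R ts => exact (realize_iff_holds hφ e).2 h
  | and φ ψ h₁ h₂ =>
    rw [Holds.and_iff] at h
    exact ⟨h₁ hφ.1 _ h.1, h₂ hφ.2 _ h.2⟩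
  | or φ ψ h₁ h₂ => exact (realize_iff_holds hφ e).2 h
  | imp φ ψ h₁ h₂ =>
    exact fun h' => h₂ hφ.2 _ ((Holds.imp_iff hI).1 h ((realize_iff_holds hφ.1 e).1 h'))
  | all φ ih =>
    intro x
    have := ih hφ _ (h.all_inst hI (Quotient.out x))
    rwa [mk_snoc, GenericModel.mk_out] at this
  | ex φ ih => exact (realize_iff_holds hφ e).2 h

theorem PosAll.close {n : ℕ} {φ : Form geo n} (hφ : φ.PosAll) : φ.close.PosAll := by
  induction n with
  | zero => exact hφ
  | succ n ih => exact ih (φ := φ.all) hφ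

end Form

end GenericModel

/-- A consistent set of assumptions has a model of its formulas with positive universal quantifiers
only. -/
theorem exists_model {T : Set (Form geo 0)} {n : ℕ} {Γ : List (Form geo n)}
    (h : ¬ Derives T Γ Form.falsum) :
    ∃ (M : Type) (_ : geo.Structure M) (v : Fin n → M),
      (∀ φ, Proves T φ → φ.PosAll → φ.Realize (Fin.elim0 : Fin 0 → M)) ∧
        ∀ γ ∈ Γ, γ.PosAll → γ.Realize v := by
  obtain ⟨I, hs, hI⟩ := ConsistentState.exists_generic ⟨n, Γ, h⟩
  refine ⟨GenericModel (T := T) (I := I) hI, inferInstance, fun i => GenericModel.mk i.val,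
    fun φ hφ hpos => ?_, fun γ hγ hpos => ?_⟩
  · have := Form.realize_of_holds (hI := hI) hpos Fin.elim0
      (Holds.of_derives hI _ fun n Γ he => (hφ.subst _).weakening (List.nil_subset _))
    convert this
  · refine Form.realize_of_holds hpos Fin.val ⟨_, hs, Fin.isLt, ?_⟩
    rw [Form.at_val]
    exact .hyp hγ

/-! ### Classical neutral geometry -/

/-- The axioms of neutral geometry that are used here, in a structure. -/
structure Neutral (M : Type) [geo.Structure M] : Prop where
  bet_ne : ∀ {a b c : M}, Bet a b c → a ≠ b ∧ b ≠ c ∧ a ≠ c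
  bet_symm : ∀ {a b c : M}, Bet a b c → Bet c b a
  outer : ∀ {a b c d : M}, BetT a b c → BetT b c d → b ≠ c → BetT a c d ∧ BetT a b d
  inner : ∀ {a b c d : M}, BetT a b d → BetT b c d → BetT a b c ∧ BetT a c d
  trans : ∀ {a b c d : M}, BetT a b c → BetT a c d → BetT b c d ∧ BetT a b d
  comparable : ∀ {a b c d : M}, Bet a b c → Bet a b d → ¬ BetT a c d → BetT a d c
  cong_swap : ∀ a b : M, Cong a b b a
  cong_trans : ∀ {a b c d e f : M}, Cong a b c d → Cong a b e f → Cong c d e f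
  cong_null : ∀ {a b c : M}, Cong a b c c → a = b
  five_segment : ∀ {a b c d a' b' c' d' : M}, a ≠ b → BetT a b c → BetT a' b' c' →
    Cong a b a' b' → Cong b c b' c' → Cong a d a' d' → Cong b d b' d' → Cong c d c' d'
  extension : ∀ {a b : M} (c d : M), a ≠ b → ∃ x, BetT a b x ∧ Cong b x c d
  inner_pasch : ∀ {a b c p q : M}, a ≠ b → ¬ OnLine c a b → Bet a p c → Bet b q c →
    ∃ x, Bet p x b ∧ Bet q x a
  circle_circle : ∀ {a b d p q : M}, a ≠ b → Cong a p a q → SegLe b p b d → SegLe b d b q →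
    ∃ x, Cong a x a p ∧ Cong b x b d

namespace Neutral

variable {M : Type} [geo.Structure M]

theorem of_axioms (h : ∀ φ, NeutralAxiom φ → φ.PosAll → φ.Realize (Fin.elim0 : Fin 0 → M)) :
    Neutral M := by
  have key : ∀ {n : ℕ} {φ : Form geo n}, NeutralAxiom φ.close → φ.PosAll → ∀ u : Fin n → M,
      φ.Realize u := fun hφ hp => (Form.realize_close _).1 (h _ hφ hp.close)
  constructor
  · intro a b c hb
    have := key .bet_ne (by simp [Form.PosAll, Form.AllFree, bet, ne, eqPt, Form.neg]) ![a, b, c]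
    simp only [Form.Realize, realize_bet, realize_ne, Matrix.cons_val] at this
    exact this hb
  · intro a b c hb
    have := key .bet_symm (by simp [Form.PosAll, Form.AllFree, bet]) ![a, b, c]
    simp only [Form.Realize, realize_bet, Matrix.cons_val] at this
    exact this hb
  · intro a b c d h₁ h₂ h₃
    have := key .bet_outer
      (by simp [Form.PosAll, Form.AllFree, bet, betT, ne, eqPt, Form.neg]) ![a, b, c, d]
    simp only [Form.Realize, realize_betT, realize_ne, Matrix.cons_val] at this
    exact this ⟨h₁, h₂, h₃⟩
  · intro a b c d h₁ h₂
    have := key .bet_inner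
      (by simp [Form.PosAll, Form.AllFree, bet, betT, ne, eqPt, Form.neg]) ![a, b, c, d]
    simp only [Form.Realize, realize_betT, Matrix.cons_val] at this
    exact this ⟨h₁, h₂⟩
  · intro a b c d h₁ h₂
    have := key .bet_trans
      (by simp [Form.PosAll, Form.AllFree, bet, betT, ne, eqPt, Form.neg]) ![a, b, c, d]
    simp only [Form.Realize, realize_betT, Matrix.cons_val] at this
    exact this ⟨h₁, h₂⟩
  · intro a b c d h₁ h₂ h₃
    have := key .bet_comparable
      (by simp [Form.PosAll, Form.AllFree, bet, betT, ne, eqPt, Form.neg]) ![a, b, c, d]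
    simp only [Form.Realize, Form.realize_neg, realize_betT, realize_bet, Matrix.cons_val] at this
    exact this ⟨h₁, h₂, h₃⟩
  · intro a b
    have := key .cong_swap (by simp [Form.PosAll, Form.AllFree, cong]) ![a, b]
    simpa only [realize_cong, Matrix.cons_val] using this
  · intro a b c d e f h₁ h₂
    have := key .cong_trans (by simp [Form.PosAll, Form.AllFree, cong]) ![a, b, c, d, e, f]
    simp only [Form.Realize, realize_cong, Matrix.cons_val] at this
    exact this ⟨h₁, h₂⟩
  · intro a b c h₁
    have := key .cong_null (by simp [Form.PosAll, Form.AllFree, cong, eqPt]) ![a, b, c]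
    simp only [Form.Realize, realize_cong, realize_eqPt, Matrix.cons_val] at this
    exact this h₁
  · intro a b c d a' b' c' d' h₁ h₂ h₃ h₄ h₅ h₆ h₇
    have := key .five_segment
      (by simp [Form.PosAll, Form.AllFree, bet, betT, ne, eqPt, cong, Form.neg])
      ![a, b, c, d, a', b', c', d']
    simp only [Form.Realize, realize_cong, realize_betT, realize_ne, Matrix.cons_val] at this
    exact this ⟨h₁, h₂, h₃, h₄, h₅, h₆, h₇⟩
  · intro a b c d h₁
    have := key .extension
      (by simp [Form.PosAll, Form.AllFree, bet, betT, ne, eqPt, cong, Form.neg]) ![a, b, c, d]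
    simp only [Form.Realize, realize_cong, realize_betT, realize_ne, snoc_apply,
      Matrix.cons_val] at this
    exact this h₁
  · intro a b c p q h₁ h₂ h₃ h₄
    have := key .inner_pasch
      (by simp [Form.PosAll, Form.AllFree, bet, nonCol, on, ne, eqPt, Form.neg]) ![a, b, c, p, q]
    simp only [Form.Realize, realize_bet, realize_nonCol, snoc_apply, Matrix.cons_val] at this
    exact this ⟨⟨h₁, h₂⟩, h₃, h₄⟩
  · intro a b d p q h₁ h₂ h₃ h₄
    have := key .circle_circle
      (by simp [Form.PosAll, Form.AllFree, segLe, betT, bet, cong, ne, eqPt, Form.neg])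
      ![a, b, d, p, q]
    simp only [Form.Realize, realize_cong, realize_segLe, realize_ne, snoc_apply,
      Matrix.cons_val] at this
    exact this ⟨h₁, h₂, h₃, h₄⟩

end Neutral

section Col

variable {M : Type} [geo.Structure M]

/-- The length of a segment: the set of all segments congruent to it. -/
def seg (a b : M) : Set (M × M) := {p | Cong a b p.1 p.2}

/-- Collinearity of three points, not necessarily distinct. -/
def Col (a b c : M) : Prop := BetT a b c ∨ BetT b c a ∨ BetT c a b

end Col

/-! ### Segment lengths, order on a line and collinearity -/

namespace Neutral

variable {M : Type} [geo.Structure M]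

theorem cong_refl (N : Neutral M) (a b : M) : Cong a b a b :=
  N.cong_trans (N.cong_swap b a) (N.cong_swap b a)

/-- Congruence becomes an equality of lengths, so that rewriting applies. -/
theorem cong_iff_seg (N : Neutral M) {a b c d : M} : Cong a b c d ↔ seg a b = seg c d := by
  refine ⟨fun h => Set.ext fun p => ⟨fun hp => N.cong_trans h hp, fun hp => ?_⟩, fun h => ?_⟩
  · exact N.cong_trans (N.cong_trans h (N.cong_refl a b)) hp
  · have : (c, d) ∈ seg a b := h ▸ N.cong_refl c d
    exact this

theorem seg_comm (N : Neutral M) (a b : M) : seg a b = seg b a :=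
  N.cong_iff_seg.1 (N.cong_swap a b)

theorem eq_of_seg (N : Neutral M) {a b c : M} (h : seg a b = seg c c) : a = b :=
  N.cong_null (N.cong_iff_seg.2 h)

theorem exists_extension (N : Neutral M) {a b : M} (h : a ≠ b) (c d : M) :
    ∃ x, BetT a b x ∧ seg b x = seg c d := by
  obtain ⟨x, h₁, h₂⟩ := N.extension c d h
  exact ⟨x, h₁, N.cong_iff_seg.1 h₂⟩

theorem seg_self (N : Neutral M) (a b : M) : seg a a = seg b b := by
  rcases eq_or_ne a b with rfl | h
  · rfl
  · obtain ⟨x, -, hx⟩ := N.exists_extension h.symm b b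
    rwa [← N.eq_of_seg hx] at hx

theorem betT_symm (N : Neutral M) {a b c : M} (h : BetT a b c) : BetT c b a := by
  rcases h with h | h | h
  · exact .inr (.inl h.symm)
  · exact .inl h.symm
  · exact .inr (.inr (N.bet_symm h))

theorem eq_of_betT_self (N : Neutral M) {a b : M} (h : BetT a b a) : a = b := by
  rcases h with h | h | h
  · exact h
  · exact h.symm
  · exact ((N.bet_ne h).2.2 rfl).elim

theorem bet_of_betT {a b c : M} (h : BetT a b c) (hab : a ≠ b) (hbc : b ≠ c) : Bet a b c :=
  (h.resolve_left hab).resolve_left hbc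

theorem betT_or_of_ne (N : Neutral M) {a b c d : M} (hab : a ≠ b) (h : BetT a b c)
    (h' : BetT a b d) : BetT a c d ∨ BetT a d c := by
  by_cases hbc : b = c
  · exact .inl (hbc ▸ h')
  by_cases hbd : b = d
  · exact .inr (hbd ▸ h)
  exact or_iff_not_imp_left.2 (N.comparable (bet_of_betT h hab hbc) (bet_of_betT h' hab hbd))

theorem betT_or_of_betT (N : Neutral M) {a b c d : M} (h : BetT a b d) (h' : BetT a c d) :
    BetT a b c ∨ BetT a c b := by
  by_cases had : a = d
  · subst had
    exact .inl (.inl (N.eq_of_betT_self h))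
  -- Seen from a point `e` beyond `a`, both `b` and `c` lie past `a`, and comparability applies.
  obtain ⟨e, he, hae⟩ := N.exists_extension (Ne.symm had) d a
  have hea : e ≠ a := fun h => had (N.eq_of_seg (hae.symm.trans (by rw [h]))).symm
  have he := N.betT_symm he
  rcases N.betT_or_of_ne hea (N.inner he h).1 (N.inner he h').1 with h₁ | h₁
  · exact .inl (N.trans (N.inner he h).1 h₁).1
  · exact .inr (N.trans (N.inner he h').1 h₁).1

theorem col_rotate {a b c : M} (h : Col a b c) : Col b c a := by
  rcases h with h | h | h
  · exact .inr (.inr h)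
  · exact .inl h
  · exact .inr (.inl h)

theorem col_swap (N : Neutral M) {a b c : M} (h : Col a b c) : Col b a c := by
  rcases h with h | h | h
  · exact .inr (.inr (N.betT_symm h))
  · exact .inr (.inl (N.betT_symm h))
  · exact .inl (N.betT_symm h)

theorem col_right_comm (N : Neutral M) {a b c : M} (h : Col a b c) : Col a c b :=
  col_rotate (N.col_swap h)

theorem col_trans (N : Neutral M) {a b c d : M} (hab : a ≠ b) (h : Col a b c) (h' : Col a b d) :
    Col a c d := by
  rcases h with h | h | h <;> rcases h' with h' | h' | h'
  · exact (N.betT_or_of_ne hab h h').imp id fun h => .inl (N.betT_symm h)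
  · exact .inr (.inl (N.betT_symm (N.trans (N.betT_symm h') h).2))
  · exact .inr (.inr (N.outer h' h hab).2)
  · exact .inl (N.trans (N.betT_symm h) h').2
  · exact (N.betT_or_of_betT (N.betT_symm h) (N.betT_symm h')).imp id fun h =>
      .inl (N.betT_symm h)
  · exact .inr (.inr (N.inner h' (N.betT_symm h)).1)
  · exact .inr (.inr (N.betT_symm (N.outer h h' hab).2))
  · exact .inr (.inr (N.betT_symm (N.inner h (N.betT_symm h')).1))
  · have h := N.betT_symm h
    have h' := N.betT_symm h'
    rcases N.betT_or_of_ne hab.symm h h' with h₁ | h₁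
    · exact .inl (N.trans h h₁).1
    · exact .inr (.inl (N.betT_symm (N.trans h' h₁).1))

theorem col_self_left (a b : M) : Col a b a := .inr (.inl (.inr (.inl rfl)))

theorem col_self_right (a b : M) : Col a b b := .inl (.inr (.inl rfl))

theorem col_of_col (N : Neutral M) {a b x y z : M} (hab : a ≠ b) (hx : Col a b x)
    (hy : Col a b y) (hz : Col a b z) : Col x y z := by
  rcases eq_or_ne a x with rfl | h
  · exact N.col_trans hab hy hz
  · exact N.col_trans h.symm (N.col_swap (N.col_trans hab hx hy))
      (N.col_swap (N.col_trans hab hx hz))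

theorem onLine_iff_col {x a b : M} (hab : a ≠ b) : OnLine x a b ↔ Col a b x := by
  constructor
  · rintro (h | h | h | rfl | rfl)
    · exact .inl (.inr (.inr h))
    · exact .inr (.inl (.inr (.inr h)))
    · exact .inr (.inr (.inr (.inr h)))
    · exact col_self_left _ _
    · exact col_self_right _ _
  · rintro ((h | h | h) | (h | h | h) | (h | h | h))
    · exact (hab h).elim
    · exact .inr (.inr (.inr (.inr h.symm)))
    · exact .inl h
    · exact .inr (.inr (.inr (.inr h.symm)))
    · exact .inr (.inr (.inr (.inl h)))
    · exact .inr (.inl h)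
    · exact .inr (.inr (.inr (.inl h)))
    · exact (hab h).elim
    · exact .inr (.inr (.inl h))

/-! ### Congruence of point configurations -/

theorem five_seg (N : Neutral M) {a b c d a' b' c' d' : M} (hab : a ≠ b) (h : BetT a b c)
    (h' : BetT a' b' c') (h₁ : seg a b = seg a' b') (h₂ : seg b c = seg b' c')
    (h₃ : seg a d = seg a' d') (h₄ : seg b d = seg b' d') : seg c d = seg c' d' := by
  rw [← N.cong_iff_seg] at *
  exact N.five_segment hab h h' h₁ h₂ h₃ h₄

/-- Extend `ac` beyond `c` to `e`. The five-segment axiom transports `ed`, and a second application,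
read backwards from `e` through `c`, reaches `b`. -/
theorem inner_five_seg (N : Neutral M) {a b c d a' b' c' d' : M} (h : BetT a b c)
    (h' : BetT a' b' c') (h₁ : seg a c = seg a' c') (h₂ : seg b c = seg b' c')
    (h₃ : seg a d = seg a' d') (h₄ : seg c d = seg c' d') : seg b d = seg b' d' := by
  by_cases hac : a = c
  · subst hac
    obtain rfl := N.eq_of_seg h₁.symm
    rwa [← N.eq_of_betT_self h, ← N.eq_of_betT_self h']
  have hac' : a' ≠ c' := by
    rintro rfl
    exact hac (N.eq_of_seg h₁)
  obtain ⟨e, he, hce⟩ := N.exists_extension hac a c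
  obtain ⟨e', he', hce'⟩ := N.exists_extension hac' a c
  have hec : e ≠ c := by
    rintro rfl
    exact hac (N.eq_of_seg hce.symm)
  have h₅ := N.five_seg hac he he' h₁ (hce.trans hce'.symm) h₃ h₄
  refine N.five_seg hec (N.betT_symm (N.trans h he).1) (N.betT_symm (N.trans h' he').1)
    ?_ ?_ h₅ h₄
  · rw [N.seg_comm e, N.seg_comm e', hce, hce']
  · rw [N.seg_comm c, N.seg_comm c', h₂]

theorem seg_eq_of_betT (N : Neutral M) {a b c a' b' c' : M} (h : BetT a b c)
    (h' : BetT a' b' c') (h₁ : seg a c = seg a' c') (h₂ : seg b c = seg b' c') :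
    seg a b = seg a' b' := by
  rw [N.seg_comm a, N.seg_comm a']
  exact N.inner_five_seg h h' h₁ h₂ (N.seg_self _ _) (by rw [N.seg_comm c, N.seg_comm c', h₁])

theorem seg_add (N : Neutral M) {a b c a' b' c' : M} (h : BetT a b c) (h' : BetT a' b' c')
    (h₁ : seg a b = seg a' b') (h₂ : seg b c = seg b' c') : seg a c = seg a' c' := by
  by_cases hab : a = b
  · subst hab
    rwa [N.eq_of_seg h₁.symm]
  · rw [N.seg_comm a, N.seg_comm a']
    exact N.five_seg hab h h' h₁ h₂ (N.seg_self _ _) (by rw [N.seg_comm b, N.seg_comm b', h₁])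

theorem extension_unique (N : Neutral M) {q a x y : M} (hqa : q ≠ a) (hx : BetT q a x)
    (hy : BetT q a y) (h : seg a x = seg a y) : x = y := by
  have := N.five_seg (d := x) (d' := y) hqa hx hx rfl rfl (N.seg_add hx hy rfl h) h
  exact (N.eq_of_seg this.symm)

/-- Copies of `ab` and `bc` are laid off in turn from `a'`, in the direction away from a point `d`
behind it. By uniqueness of extension the end is `c'`. -/
theorem exists_betT_of_seg (N : Neutral M) {a b c a' c' : M} (h : BetT a b c)
    (h₁ : seg a c = seg a' c') :
    ∃ b', BetT a' b' c' ∧ seg a b = seg a' b' ∧ seg b c = seg b' c' := by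
  by_cases hac : a' = c'
  · subst hac
    obtain rfl := N.eq_of_seg h₁
    obtain rfl := N.eq_of_betT_self h
    exact ⟨a', .inl rfl, h₁, h₁⟩
  obtain ⟨d, hd, hcd⟩ := N.exists_extension (Ne.symm hac) a' c'
  have hda : d ≠ a' := by
    rintro rfl
    exact hac (N.eq_of_seg hcd.symm)
  obtain ⟨b', hb, hab⟩ := N.exists_extension hda a b
  have hdb : d ≠ b' := by
    rintro rfl
    exact hda (N.eq_of_betT_self hb)
  obtain ⟨x, hx, hbx⟩ := N.exists_extension hdb b c
  have h₂ := N.trans hb hx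
  have h₃ := N.seg_add h h₂.1 hab.symm hbx.symm
  obtain rfl := N.extension_unique hda h₂.2 (N.betT_symm hd) (h₃.symm.trans h₁)
  exact ⟨b', h₂.1, hab.symm, hbx.symm⟩

/-- The copy `x` of `b` in `a'c'` has the same distances to `a'` and `c'` as `b'`. The inner
five-segment lemma then gives `x` and `b'` distance zero. -/
theorem betT_of_seg (N : Neutral M) {a b c a' b' c' : M} (h : BetT a b c)
    (h₁ : seg a b = seg a' b') (h₂ : seg b c = seg b' c') (h₃ : seg a c = seg a' c') :
    BetT a' b' c' := by
  obtain ⟨x, hx, hax, hxc⟩ := N.exists_betT_of_seg h h₃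
  have := N.inner_five_seg (d := x) (d' := b') hx hx rfl rfl (hax.symm.trans h₁)
    (by rw [N.seg_comm c' x, N.seg_comm c' b', ← hxc, h₂])
  rwa [← N.eq_of_seg this.symm]

/-! ### Midpoints -/

/-- Euclid I.1: the circles around `a` and `b` with radius `ab` meet. On the first, `b` is inside
the second circle and its antipode `q` is outside. -/
theorem exists_isosceles (N : Neutral M) {a b : M} (h : a ≠ b) : ∃ c, seg c a = seg c b := by
  obtain ⟨q, hq, haq⟩ := N.exists_extension h.symm a b
  have h₁ : SegLe b b b a := ⟨b, .inl rfl, N.cong_refl b b⟩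
  have h₂ : SegLe b a b q := ⟨a, hq, N.cong_refl b a⟩
  obtain ⟨c, hc₁, hc₂⟩ := N.circle_circle h (N.cong_iff_seg.2 haq.symm) h₁ h₂
  rw [N.cong_iff_seg] at hc₁ hc₂
  exact ⟨c, by rw [N.seg_comm c, N.seg_comm c, hc₁, hc₂, N.seg_comm]⟩

theorem exists_midpoint_of_isosceles (N : Neutral M) {a b c : M} (hab : a ≠ b)
    (hc : seg c a = seg c b) (hcol : ¬ Col c a b) :
    ∃ m, Bet a m b ∧ seg a m = seg b m := by
  have hca : c ≠ a := by
    rintro rfl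
    exact hab (N.eq_of_seg hc.symm)
  have hcb : c ≠ b := by
    rintro rfl
    exact hab (N.eq_of_seg hc).symm
  obtain ⟨p, hp, hap⟩ := N.exists_extension hca a b
  obtain ⟨q, hq, hbq⟩ := N.exists_extension hcb a b
  have hpa : a ≠ p := by
    rintro rfl
    exact hab (N.eq_of_seg hap.symm)
  have hqb : b ≠ q := by
    rintro rfl
    exact hab (N.eq_of_seg hbq.symm)
  have hcp : c ≠ p := by
    rintro rfl
    exact hpa (N.eq_of_betT_self hp).symm
  have hcq : c ≠ q := by
    rintro rfl
    exact hqb (N.eq_of_betT_self hq).symm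
  have hcpa : Col c p a := .inr (.inl (N.betT_symm hp))
  have hcqb : Col c q b := .inr (.inl (N.betT_symm hq))
  have hcap : Col c a p := .inl hp
  have hcpb : ¬ Col c p b := fun h => hcol (N.col_trans hcp hcpa h)
  have hcpq : ¬ Col c p q := fun h => hcpb (N.col_trans hcq (N.col_right_comm h) hcqb)
  have hpq : p ≠ q := by
    rintro rfl
    exact hcpq (col_self_right _ _)
  -- The legs are prolonged equally to `p` and `q`, and the diagonals `aq` and `bp` cross in `r`. A
  -- second use of Pasch makes `cr` cross `ab` in `x`, the midpoint.
  obtain ⟨r, hr₁, hr₂⟩ := N.inner_pasch hpq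
    (by rw [onLine_iff_col hpq]; exact fun h => hcpq (col_rotate (col_rotate h)))
    (N.bet_symm (bet_of_betT hp hca hpa)) (N.bet_symm (bet_of_betT hq hcb hqb))
  obtain ⟨x, hx₁, hx₂⟩ := N.inner_pasch hcb
    (by rw [onLine_iff_col hcb]; exact fun h => hcpb (N.col_right_comm h))
    (bet_of_betT hp hca hpa) hr₂
  have hpb : seg p b = seg q a := N.five_seg hca hp hq hc (hap.trans hbq.symm) hc.symm
    (N.seg_comm a b)
  have hTr : BetT b r p := .inr (.inr hr₂)
  -- `r'` is the image of `r` under the symmetry exchanging `a` with `b` and `p` with `q`. It lies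
  -- on both diagonals, hence equals `r`, and this gives `ra = rb`.
  obtain ⟨r', hr', hbr, hrp⟩ := N.exists_betT_of_seg (a' := a) (c' := q) hTr
    (by rw [N.seg_comm b, hpb, N.seg_comm])
  have h₁ : seg r a = seg r' b := N.inner_five_seg hTr hr'
    (by rw [N.seg_comm b, hpb, N.seg_comm]) hrp (N.seg_comm b a)
    (by rw [N.seg_comm p, hap, ← hbq, N.seg_comm])
  have h₂ : seg r q = seg r' p := N.inner_five_seg hTr hr'
    (by rw [N.seg_comm b, hpb, N.seg_comm]) hrp (hbq.trans hap.symm) (N.seg_comm p q)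
  have h₃ : BetT b r' p := N.betT_of_seg (a := a) (b := r) (c := q) (.inr (.inr hr₁))
    (by rw [N.seg_comm a, h₁, N.seg_comm]) h₂ (by rw [N.seg_comm a, ← hpb, N.seg_comm])
  have hrr : r = r' := by
    by_contra hne
    have haq : a ≠ q := by
      rintro rfl
      exact hcol hcqb
    have hbp : b ≠ p := by
      rintro rfl
      exact hcol (N.col_right_comm hcpa)
    have col_of_betT : ∀ {x y z : M}, BetT x y z → Col x z y := fun h =>
      .inr (.inl (N.betT_symm h))
    have hr₁ := col_of_betT (.inr (.inr hr₁))
    have h₄ := N.col_of_col haq hr₁ (col_of_betT hr') (col_self_left _ _)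
    have h₅ := N.col_of_col hbp (col_of_betT hTr) (col_of_betT h₃) (col_self_left _ _)
    have h₆ := N.col_of_col hbp (col_of_betT hTr) (col_of_betT h₃) (col_self_right _ _)
    have h₇ := N.col_right_comm (N.col_of_col hne h₄ h₅ h₆)
    exact hcol (N.col_swap (N.col_trans hpa (col_rotate hcap) h₇))
  subst hrr
  refine ⟨x, hx₁, ?_⟩
  rw [N.seg_comm a, N.seg_comm b]
  exact N.inner_five_seg (.inr (.inr hx₂)) (.inr (.inr hx₂)) rfl rfl h₁ hc

theorem exists_midpoint (N : Neutral M) {a b : M} (hab : a ≠ b) :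
    ∃ m, Bet a m b ∧ seg a m = seg b m := by
  obtain ⟨c, hc⟩ := N.exists_isosceles hab
  by_cases hcol : Col c a b
  · have hca : c ≠ a := by
      rintro rfl
      exact hab (N.eq_of_seg hc.symm)
    have hcb : c ≠ b := by
      rintro rfl
      exact hab (N.eq_of_seg hc).symm
    -- A collinear point equidistant from `a` and `b` is itself the midpoint; any other order would
    -- put a segment properly inside a congruent one.
    rcases hcol with h | h | h
    · exact (hab (N.eq_of_seg (N.seg_eq_of_betT (N.betT_symm h) (.inl rfl : BetT b b c) rfl
        (by rw [N.seg_comm a, hc, N.seg_comm]))).symm).elim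
    · exact (hab (N.eq_of_seg (N.seg_eq_of_betT h (.inl rfl : BetT a a c) rfl
        (by rw [N.seg_comm b, ← hc, N.seg_comm])))).elim
    · exact ⟨c, N.bet_symm (bet_of_betT h hcb.symm hca), by rw [N.seg_comm a, hc, N.seg_comm]⟩
  · exact N.exists_midpoint_of_isosceles hab hc hcol

/-! ### The strong parallel postulate implies Playfair's axiom -/

/-- The strong parallel postulate in a structure for the language of geometry. -/
def StrongParallel (M : Type) [geo.Structure M] : Prop :=
  ∀ p q r s t a : M, Bet p t q → Bet s t r → s ≠ q → ¬ OnLine p s q → p ≠ r → p ≠ a →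
    ¬ OnLine a p r → Cong p t q t → Cong r t s t → ∃ x, OnLine x s q ∧ OnLine x p a

/-- Under the strong parallel postulate all points of parallels to a line through a given point lie
on one line. -/
theorem exists_unique_parallel (N : Neutral M) (hM : StrongParallel M) {l₁ l₂ p : M}
    (hl : l₁ ≠ l₂) (hp : ¬ Col l₁ l₂ p) :
    ∃ r, p ≠ r ∧ ∀ k₁ k₂ x : M, k₁ ≠ k₂ → (∀ x, ¬ (OnLine x k₁ k₂ ∧ OnLine x l₁ l₂)) →
      OnLine p k₁ k₂ → OnLine x k₁ k₂ → Col p r x := by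
  have hpl : p ≠ l₁ := by
    rintro rfl
    exact hp (col_self_left _ _)
  obtain ⟨t, ht, hpt⟩ := N.exists_midpoint hpl
  have hcol : Col p l₁ t := .inr (.inl (.inr (.inr (N.bet_symm ht))))
  have htl : l₂ ≠ t := by
    rintro rfl
    exact hp (col_rotate hcol)
  -- `r` is the reflection of `l₂` in the midpoint `t` of `p` and `l₁`, so `pr` is the line compared
  -- with `L` in the postulate.
  obtain ⟨r, hr, htr⟩ := N.exists_extension htl l₂ t
  have htr' : t ≠ r := by
    rintro rfl
    exact htl (N.eq_of_seg htr.symm)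
  have hpr : p ≠ r := by
    rintro rfl
    have h₁ : Col p t l₂ := N.col_swap (col_rotate (.inl hr))
    exact hp (N.col_swap (col_rotate (N.col_trans htr'.symm h₁ (N.col_right_comm hcol))))
  refine ⟨r, hpr, fun k₁ k₂ x hk hpar hpk hxk => ?_⟩
  by_contra hx
  have hpx : p ≠ x := by
    rintro rfl
    exact hx (col_self_left _ _)
  -- If `x` were off `pr`, the postulate would make `px`, the supposed parallel, meet `L`.
  obtain ⟨e, he₁, he₂⟩ := hM p l₁ r l₂ t x ht (bet_of_betT hr htl htr') hl.symm
    (by rw [onLine_iff_col hl.symm]; exact fun h => hp (N.col_swap h)) hpr hpx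
    (by rwa [onLine_iff_col hpr]) (N.cong_iff_seg.2 hpt)
    (N.cong_iff_seg.2 (by rw [N.seg_comm, htr]))
  rw [onLine_iff_col hl.symm] at he₁
  rw [onLine_iff_col hpx] at he₂
  refine hpar e ⟨?_, (onLine_iff_col hl).2 (N.col_swap he₁)⟩
  rw [onLine_iff_col hk] at hpk hxk ⊢
  exact N.col_of_col hpx (N.col_of_col hk hpk hxk (col_self_left _ _))
    (N.col_of_col hk hpk hxk (col_self_right _ _)) he₂

theorem playfair_of_strongParallel (N : Neutral M) (hM : StrongParallel M) : Playfair M := by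
  intro k₁ k₂ l₁ l₂ m₁ m₂ p q hk hl hm hkl hml hpk hpm hqk
  obtain ⟨r, hpr, h⟩ := N.exists_unique_parallel hM hl
    fun hp => hkl p ⟨hpk, (onLine_iff_col hl).2 hp⟩
  rw [onLine_iff_col hm]
  exact N.col_of_col hpr
    (h m₁ m₂ m₁ hm hml hpm ((onLine_iff_col hm).2 (col_self_left _ _)))
    (h m₁ m₂ m₂ hm hml hpm ((onLine_iff_col hm).2 (col_self_right _ _)))
    (h k₁ k₂ q hk hkl hpk hqk)

end Neutral

/-! ### The strong parallel postulate proves Playfair's axiom -/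

theorem Form.AllFree.subst {n : ℕ} {φ : Form geo n} (h : φ.AllFree) :
    ∀ {m : ℕ} (σ : Fin n → geo.Term (Fin m)), (φ.subst σ).AllFree := by
  induction φ with
  | falsum => intros; trivial
  | equal s t => intros; trivial
  | rel R ts => intros; trivial
  | and φ ψ h₁ h₂ => exact fun σ => ⟨h₁ h.1 σ, h₂ h.2 σ⟩
  | or φ ψ h₁ h₂ => exact fun σ => ⟨h₁ h.1 σ, h₂ h.2 σ⟩
  | imp φ ψ h₁ h₂ => exact fun σ => ⟨h₁ h.1 σ, h₂ h.2 σ⟩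
  | all φ ih => exact h.elim
  | ex φ ih => exact fun σ => ih h _

theorem Form.PosAll.subst {n : ℕ} {φ : Form geo n} (h : φ.PosAll) :
    ∀ {m : ℕ} (σ : Fin n → geo.Term (Fin m)), (φ.subst σ).PosAll := by
  induction φ with
  | falsum => intros; trivial
  | equal s t => intros; trivial
  | rel R ts => intros; trivial
  | and φ ψ h₁ h₂ => exact fun σ => ⟨h₁ h.1 σ, h₂ h.2 σ⟩
  | or φ ψ h₁ h₂ => exact fun σ => ⟨Form.AllFree.subst h.1 σ, Form.AllFree.subst h.2 σ⟩
  | imp φ ψ h₁ h₂ => exact fun σ => ⟨Form.AllFree.subst h.1 σ, h₂ h.2 σ⟩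
  | all φ ih => exact fun σ => ih h _
  | ex φ ih => exact fun σ => Form.AllFree.subst h _

theorem Derives.close {L : FirstOrder.Language.{0, 0}} {T : Set (Form L 0)} {Γ : List (Form L 0)}
    {n : ℕ} {φ : Form L n} (h : Derives T (Γ.map (Form.ofSentence n)) φ) :
    Derives T Γ φ.close := by
  induction n with
  | zero =>
    have : Γ.map (Form.ofSentence 0) = Γ := by
      rw [show Form.ofSentence (L := L) 0 = id from funext Form.ofSentence_zero, List.map_id]
    rwa [this] at h
  | succ n ih =>
    refine ih (.allI ?_)
    simpa [Function.comp_def, Form.weaken, Form.ofSentence_subst] using h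

theorem posAll_strongParallel : strongParallel.PosAll :=
  Form.PosAll.close (by
    simp [strongParallelAt, Form.PosAll, Form.AllFree, bet, cong, meet, on, ne, eqPt, Form.neg])

theorem strongParallel_of_realize {M : Type} [geo.Structure M]
    (h : strongParallel.Realize (Fin.elim0 : Fin 0 → M)) : Neutral.StrongParallel M := by
  intro p q r s t a h₁ h₂ h₃ h₄ h₅ h₆ h₇ h₈ h₉
  have := (Form.realize_close _).1 h ![p, q, r, s, t, a]
  simp only [strongParallelAt, Form.Realize, Form.realize_neg, realize_bet, realize_cong,
    realize_ne, realize_on, realize_meet, Matrix.cons_val] at this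
  exact this ⟨h₁, h₂, h₃, h₄, h₅, h₆, h₇, h₈, h₉⟩

/-- Under the strong parallel postulate there are no counterexamples to Playfair's axiom. -/
theorem derives_falsum_of_playfair_hyp {T : Set (Form geo 0)} (hT : IsNeutralTheory T) {n : ℕ}
    {k₁ k₂ l₁ l₂ m₁ m₂ p q : Fin n} {Γ : List (Form geo n)}
    (hΓ : strongParallel.ofSentence n ∈ Γ)
    (h₁ : (ne k₁ k₂ ⋏ ne l₁ l₂ ⋏ ne m₁ m₂ ⋏ parallel k₁ k₂ l₁ l₂ ⋏ parallel m₁ m₂ l₁ l₂ ⋏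
      on p k₁ k₂ ⋏ on p m₁ m₂) ∈ Γ)
    (h₂ : on q k₁ k₂ ∈ Γ ∧ (on q m₁ m₂).neg ∈ Γ ∨ on q m₁ m₂ ∈ Γ ∧ (on q k₁ k₂).neg ∈ Γ) : Derives T Γ Form.falsum := by
  -- If no contradiction were derivable, there would be a classical model in which the strong
  -- parallel postulate holds and Playfair's axiom fails.
  by_contra h
  obtain ⟨M, _, u, hM, hu⟩ := exists_model h
  have N : Neutral M := .of_axioms fun φ hφ => hM φ (hT φ hφ)
  have hs := hu _ hΓ (posAll_strongParallel.subst _)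
  rw [Form.realize_ofSentence] at hs
  have hP := N.playfair_of_strongParallel (strongParallel_of_realize hs)
  have h₁ := hu _ h₁
    (by simp [Form.PosAll, Form.AllFree, parallel, bet, on, ne, eqPt, Form.neg])
  simp only [Form.Realize, realize_ne, realize_parallel, realize_on] at h₁
  obtain ⟨hk, hl, hm, hkl, hml, hpk, hpm⟩ := h₁
  have on_iff : ∀ a b : Fin n, (on q a b ∈ Γ → OnLine (u q) (u a) (u b)) ∧
      ((on q a b).neg ∈ Γ → ¬ OnLine (u q) (u a) (u b)) := fun a b => by
    rw [← realize_on, ← Form.realize_neg]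
    exact ⟨fun h => hu _ h (by simp [Form.PosAll, Form.AllFree, bet, on, eqPt, Form.neg]),
      fun h => hu _ h (by simp [Form.PosAll, Form.AllFree, bet, on, eqPt, Form.neg])⟩
  rcases h₂ with ⟨h₂, h₃⟩ | ⟨h₂, h₃⟩
  · exact (on_iff _ _).2 h₃ (hP _ _ _ _ _ _ _ _ hk hl hm hkl hml hpk hpm ((on_iff _ _).1 h₂))
  · exact (on_iff _ _).2 h₃ (hP _ _ _ _ _ _ _ _ hm hl hk hml hkl hpm hpk ((on_iff _ _).1 h₂))

/-- Being on a line is a stable property. -/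
theorem derives_on_of_not_not {T : Set (Form geo 0)} {n : ℕ} {Γ : List (Form geo n)}
    {a b c : Fin n} (h : Derives T ((on a b c).neg :: Γ) Form.falsum) : Derives T Γ (on a b c) := by
  exact .impI (.impE ((Derives.impI h).weakening (List.subset_cons_self _ _))
    (.impI (.impE (.hyp List.mem_cons_self) (.hyp (List.mem_cons_of_mem _ List.mem_cons_self)))))

theorem proves_strongParallel_imp_playfair {T : Set (Form geo 0)} (hT : IsNeutralTheory T) :
    Proves T (strongParallel ⇛ playfair) := by
  -- Each half of the equivalence ends in a stable incidence statement, so its negation may be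
  -- assumed.
  refine .impI (Derives.close (.impI (.andI (.impI (derives_on_of_not_not ?_))
    (.impI (derives_on_of_not_not ?_)))))
  · exact derives_falsum_of_playfair_hyp (k₁ := 0) (k₂ := 1) (l₁ := 2) (l₂ := 3) (m₁ := 4)
      (m₂ := 5) (p := 6) (q := 7) hT (by simp) (by simp) (by simp)
  · exact derives_falsum_of_playfair_hyp (k₁ := 0) (k₂ := 1) (l₁ := 2) (l₂ := 3) (m₁ := 4)
      (m₂ := 5) (p := 6) (q := 7) hT (by simp) (by simp) (by simp)

end ConstructiveGeometry

/-! ### The theorem and its corollary -/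

open ConstructiveGeometry
theorem mainTheorem3 (T : Set (Form geo 0)) (hT : IsNeutralTheory T)
    (hsound : SoundInPlayfairRings T) :
    Proves T (strongParallel ⇛ playfair) ∧
    ¬ Proves T (playfair ⇛ strongParallel) ∧
    ¬ Proves T (playfair ⇛ euclid5) ∧
    ¬ Proves T (playfair ⇛ triangleCircumscription) ∧
    ¬ Proves T (playfair ⇛ strongCircumscription) ∧
    ¬ Proves T (playfair ⇛ oneSidedCircumscription) ∧
    ¬ Proves T (playfair ⇛ nonuniformCircumscription) := by
  have h₀ := Hyperreal.epsilon_pos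
  have hε := natCast_mul_epsilon_lt_one
  exact ⟨proves_strongParallel_imp_playfair hT,
    not_proves_playfair_imp hsound (not_force_strongParallel h₀ hε),
    not_proves_playfair_imp hsound (not_force_euclid5 h₀ hε),
    not_proves_playfair_imp hsound (not_force_triangleCircumscription h₀ hε),
    not_proves_playfair_imp hsound (not_force_strongCircumscription h₀ hε),
    not_proves_playfair_imp hsound (not_force_oneSidedCircumscription h₀ hε),
    not_proves_playfair_imp hsound (not_force_nonuniformCircumscription h₀ hε)⟩
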